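/- Let $k \ge 1$, let $\ell_1,\dots,\ell_4$ be four pairwise distinct lines and let $C_1,\dots,C_k$ be $k$ pairwise distinct smooth conics in the complex projective plane $\mathbb{P}^2_{\mathbb{C}}$. Let $f \in S=\mathbb{C}[x,y,z]$ be the product of their defining equations, so that $f=0$ is a reduced curve of degree $2k+4$, and suppose that every singular point of this curve is a node, a tacnode or an ordinary triple point (that is, the germ of the curve there is isomorphic to the germ at the origin of $xy=0$, of $y(y-x^2)=0$, or of $xy(x+y)=0$, respectively). Then the arrangement is not free. Here the curve $f=0$ is called free if $N(f)=I_f/J_f=0$, where $J_f=\langle \partial_x f,\partial_y f,\partial_z f\rangle$ is the Jacobian ideal of $f$ and $I_f$ is its saturation with respect to the ideal $\langle x,y,z\rangle$. -/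

import Mathlib

noncomputable section

namespace ConicLine

/-- The homogeneous coordinate ring `S = ℂ[x, y, z]` of the complex projective plane. -/
abbrev S : Type := MvPolynomial (Fin 3) ℂ

/-- The ring `ℂ⟦x, y⟧` of formal power series, with `x = X 0` and `y = X 1`. -/
abbrev R : Type := MvPowerSeries (Fin 2) ℂ

/-! ### Free curves -/

/-- The Jacobian ideal `J_f`, generated by the three partial derivatives of `f`. -/
def jacobianIdeal (f : S) : Ideal S :=
  Ideal.span (Set.range fun i : Fin 3 => MvPolynomial.pderiv i f)

/-- The irrelevant ideal `𝔪 = (x, y, z)`. -/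
def irrelevantIdeal : Ideal S :=
  Ideal.span (Set.range fun i : Fin 3 => (MvPolynomial.X i : S))

/-- The saturation `⋃ₙ (J : 𝔪ⁿ)` of an ideal with respect to `𝔪`
(the union is increasing, so it is the supremum). -/
def saturation (J : Ideal S) : Ideal S :=
  ⨆ n : ℕ, Submodule.colon J ((irrelevantIdeal ^ n : Ideal S) : Set S)

/-- The module `N(f) = I_f / J_f`, where `I_f` is the saturation of `J_f`. -/
abbrev moduleN (f : S) : Type :=
  ↥(saturation (jacobianIdeal f)) ⧸
    Submodule.submoduleOf (jacobianIdeal f) (saturation (jacobianIdeal f))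

/-- The plane curve `f = 0` is free: `N(f) = 0`. -/
def IsFree (f : S) : Prop := Subsingleton (moduleN f)

/-! ### Singular points and their types -/

/-- The curve `f = 0` passes through the point with homogeneous coordinates `v`
and is singular there. -/
def IsSingularAt (f : S) (v : Fin 3 → ℂ) : Prop :=
  MvPolynomial.eval v f = 0 ∧ ∀ i, MvPolynomial.eval v (MvPolynomial.pderiv i f) = 0

/-- The equation `f (v + x w₁ + y w₂)` in `ℂ⟦x, y⟧`. If `v, w₁, w₂` is a basis of `ℂ³`, this is
the equation of the curve `f = 0` in the affine coordinates `x, y` centred at the point `[v]`. -/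
def localEquation (f : S) (v w₁ w₂ : Fin 3 → ℂ) : R :=
  MvPolynomial.aeval
    (fun i : Fin 3 => (MvPowerSeries.C (v i) + MvPowerSeries.C (w₁ i) * MvPowerSeries.X 0
      + MvPowerSeries.C (w₂ i) * MvPowerSeries.X 1 : R)) f

/-- The germ of the curve `f = 0` at the point `[v]` is isomorphic to the germ of `g = 0` at the
origin: in suitable formal coordinates, the local equation of the curve is `g` up to a unit. -/
def HasLocalType (f : S) (v : Fin 3 → ℂ) (g : R) : Prop :=
  ∃ w₁ w₂ : Fin 3 → ℂ, LinearIndependent ℂ ![v, w₁, w₂] ∧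
    ∃ φ : R ≃ₐ[ℂ] R, Associated (φ (localEquation f v w₁ w₂)) g

/-- A node (`A₁`): two smooth branches crossing transversally, locally `x y = 0`. -/
def IsNode (f : S) (v : Fin 3 → ℂ) : Prop :=
  HasLocalType f v (MvPowerSeries.X 0 * MvPowerSeries.X 1)

/-- A tacnode (`A₃`): two smooth branches with a simple tangency, locally `y (y - x²) = 0`
(equivalently `y² + x⁴ = 0`). -/
def IsTacnode (f : S) (v : Fin 3 → ℂ) : Prop :=
  HasLocalType f v (MvPowerSeries.X 1 * (MvPowerSeries.X 1 - MvPowerSeries.X 0 ^ 2))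

/-- An ordinary triple point (`D₄`): three smooth branches with distinct tangents, locally
`x y (x + y) = 0` (equivalently `x³ + y³ = 0`). -/
def IsOrdinaryTriplePoint (f : S) (v : Fin 3 → ℂ) : Prop :=
  HasLocalType f v
    (MvPowerSeries.X 0 * MvPowerSeries.X 1 * (MvPowerSeries.X 0 + MvPowerSeries.X 1))

/-- All singular points of the curve `f = 0` in the projective plane are nodes, tacnodes or
ordinary triple points. -/
def OnlyNodesTacnodesTriplePoints (f : S) : Prop :=
  ∀ v : Fin 3 → ℂ, v ≠ 0 → IsSingularAt f v →
    IsNode f v ∨ IsTacnode f v ∨ IsOrdinaryTriplePoint f v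

/-! ### Conic-line arrangements -/

/-- An arrangement of `d` pairwise distinct lines and `k` pairwise distinct smooth conics in the
complex projective plane, given by their equations. -/
structure Arrangement (d k : ℕ) where
  line : Fin d → S
  conic : Fin k → S
  line_isHomogeneous : ∀ i, (line i).IsHomogeneous 1
  line_ne_zero : ∀ i, line i ≠ 0
  line_distinct : ∀ i j, i ≠ j → ¬ Associated (line i) (line j)
  conic_isHomogeneous : ∀ i, (conic i).IsHomogeneous 2
  conic_smooth : ∀ i, ∀ v : Fin 3 → ℂ, v ≠ 0 → ¬ IsSingularAt (conic i) v
  conic_distinct : ∀ i j, i ≠ j → ¬ Associated (conic i) (conic j)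

/-- The equation of the union of all the lines and conics of the arrangement. -/
def Arrangement.equation {d k : ℕ} (A : Arrangement d k) : S :=
  (∏ i, A.line i) * ∏ j, A.conic j

end ConicLine

end

/-! Let `f` be the equation, of degree `2k + 4`. If `f` is free, some linear form `L` is regular
modulo the Jacobian ideal, so syzygies of the partial derivatives restrict to the line `L = 0` with
kernel `L` times syzygies of one degree less; counting dimensions gives four independent syzygies of
degree `k + 2`. Contracting them with the Euler field and the volume form yields four independent
`1`-forms with coefficients of degree `k + 3` that leave every component invariant.

Conversely, the forms that leave curves invariant can be restricted to one smooth rational component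
of degree `e`. On it such a form becomes a section of a line bundle vanishing at the intersection
points with the other components, and its kernel consists of the multiples of the equation of the
component, so removing that component costs at most `e s + 1 - e (e - 1)` minus the number of those
points, where `s` is the degree of the coefficients. The three types of singularities allow each
component to meet the union of the others with multiplicity at most two at any point, so by Bézout
there are many such points. Removing a conic, then a line whose three complementary lines form a
triangle, and then everything else, bounds the dimension by `3 + 1 + 0 = 4`.

Hence equality holds throughout: the conic meets the other components only with multiplicity two,
and the line has only one simple intersection point with the components other than the conic. So the
line is tangent to the conic, for two transversal points would be two such simple points. As three
concurrent lines cannot all be tangent to a conic, no three of the lines are concurrent. But then a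
line meets two of the other lines in two distinct simple points, a contradiction. -/

noncomputable section

namespace ConicLine

open MvPolynomial
open scoped Polynomial

/-! ### Homogeneous polynomials -/

section HomogeneousPolynomials

variable {σ R A : Type*}

theorem dvd_aeval_sub_aeval [CommRing R] [CommRing A] [Algebra R A] {P : A} {a b : σ → A}
    (h : ∀ i, P ∣ a i - b i) (G : MvPolynomial σ R) : P ∣ aeval a G - aeval b G := by
  have hquot (i : σ) : Ideal.Quotient.mkₐ R (Ideal.span {P}) (a i) =
      Ideal.Quotient.mkₐ R (Ideal.span {P}) (b i) :=
    Ideal.Quotient.eq.mpr (Ideal.mem_span_singleton.mpr (h i))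
  rw [← Ideal.mem_span_singleton, ← Ideal.Quotient.eq, ← Ideal.Quotient.mkₐ_eq_mk R,
    comp_aeval_apply, comp_aeval_apply, _root_.funext hquot]

theorem aeval_smul_of_isHomogeneous [CommSemiring R] [CommSemiring A] [Algebra R A]
    {G : MvPolynomial σ R} {d : ℕ} (hG : G.IsHomogeneous d) (c : A) (y : σ → A) :
    aeval (c • y) G = c ^ d * aeval y G := by
  rw [aeval_def, aeval_def, eval₂_eq, eval₂_eq, Finset.mul_sum]
  refine Finset.sum_congr rfl fun m hm => ?_
  simp only [Pi.smul_apply, smul_eq_mul, mul_pow, Finset.prod_mul_distrib,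
    Finset.prod_pow_eq_pow_sum, ← hG.degree_eq_sum_deg_support hm]
  ring

theorem eval_smul_of_isHomogeneous [CommSemiring R] {G : MvPolynomial σ R} {d : ℕ}
    (hG : G.IsHomogeneous d) (c : R) (y : σ → R) : eval (c • y) G = c ^ d * eval y G :=
  aeval_smul_of_isHomogeneous hG c y

theorem eval_smul_eq_zero_iff [CommSemiring R] [NoZeroDivisors R] {G : MvPolynomial σ R} {d : ℕ}
    (hG : G.IsHomogeneous d) {c : R} (hc : c ≠ 0) (y : σ → R) :
    eval (c • y) G = 0 ↔ eval y G = 0 := by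
  have : Nontrivial R := ⟨c, 0, hc⟩
  rw [eval_smul_of_isHomogeneous hG, mul_eq_zero, or_iff_right (pow_ne_zero d hc)]

theorem eval_aeval_mvPolynomial [CommSemiring R] {τ : Type*} (f : τ → MvPolynomial σ R)
    (y : σ → R) (G : MvPolynomial τ R) : eval y (aeval f G) = eval (fun j => eval y (f j)) G :=
  comp_aeval_apply f (aeval y) G

theorem eval_aeval_polynomial [CommSemiring R] (φ : σ → R[X]) (t : R) (G : MvPolynomial σ R) :
    (aeval φ G).eval t = eval (fun i => (φ i).eval t) G := by
  rw [aeval_def, polynomial_eval_eval₂, ← eval₂_id]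
  congr 1
  ext r
  simp

theorem natDegree_aeval_le [CommSemiring R] {φ : σ → R[X]} {e d : ℕ}
    (hφ : ∀ i, (φ i).natDegree ≤ e) {G : MvPolynomial σ R} (hG : G.IsHomogeneous d) :
    (aeval φ G).natDegree ≤ e * d := by
  rw [aeval_def, eval₂_eq]
  refine Polynomial.natDegree_sum_le_of_forall_le _ _ fun m hm => ?_
  refine (Polynomial.natDegree_C_mul_le _ _).trans <| (Polynomial.natDegree_prod_le _ _).trans ?_
  rw [hG.degree_eq_sum_deg_support hm, Finset.mul_sum]
  refine Finset.sum_le_sum fun i _ => Polynomial.natDegree_pow_le.trans ?_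
  rw [mul_comm]
  exact Nat.mul_le_mul_right _ (hφ i)

theorem homogenize_aeval [CommSemiring R] {φ : σ → R[X]} {e d : ℕ}
    (hφ : ∀ i, (φ i).natDegree ≤ e) {G : MvPolynomial σ R} (hG : G.IsHomogeneous d) :
    (aeval φ G).homogenize (e * d) = aeval (fun i => (φ i).homogenize e) G := by
  refine Polynomial.homogenize_eq_of_isHomogeneous
    (hG.aeval _ fun i => Polynomial.isHomogeneous_homogenize _) ?_
  rw [comp_aeval_apply]
  simp only [Polynomial.aeval_homogenize_X_one _ (hφ _)]

theorem aeval_one_zero_homogenize [CommSemiring R] (p : R[X]) (n : ℕ) :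
    aeval (![1, 0] : Fin 2 → R) (p.homogenize n) = p.coeff n := by
  rw [Polynomial.homogenize, map_sum, Finset.sum_eq_single (n, 0)]
  · simp [aeval_monomial, Finsupp.prod_fintype]
  · rintro ⟨a, b⟩ hab hne
    have hb : b ≠ 0 := by
      rintro rfl
      simp_all
    simp [aeval_monomial, Finsupp.prod_fintype, hb]
  · simp

theorem coeff_aeval [CommSemiring R] {φ : σ → R[X]} {e d : ℕ} (hφ : ∀ i, (φ i).natDegree ≤ e)
    {G : MvPolynomial σ R} (hG : G.IsHomogeneous d) :
    (aeval φ G).coeff (e * d) = eval (fun i => (φ i).coeff e) G := by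
  rw [← aeval_one_zero_homogenize, homogenize_aeval hφ hG, comp_aeval_apply]
  simp only [aeval_one_zero_homogenize, ← coe_aeval_eq_eval]
  rfl

theorem derivative_aeval [CommSemiring R] [Fintype σ] (φ : σ → R[X]) (G : MvPolynomial σ R) :
    (aeval φ G).derivative = ∑ i, aeval φ (pderiv i G) * (φ i).derivative := by
  classical
  induction G using MvPolynomial.induction_on with
  | C a => simp
  | add p q hp hq => simp only [map_add, hp, hq, add_mul, Finset.sum_add_distrib]
  | mul_X p j hp =>
    simp only [map_mul, aeval_X, Polynomial.derivative_mul, hp, Derivation.leibniz, smul_eq_mul,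
      map_add, pderiv_X, Pi.single_apply, mul_ite, mul_one, mul_zero, apply_ite (aeval φ), map_zero,
      add_mul, ite_mul, zero_mul, Finset.sum_add_distrib, Finset.sum_mul, Finset.sum_ite_eq,
      Finset.mem_univ, if_true]
    rw [add_comm]
    exact congrArg _ (Finset.sum_congr rfl fun i _ => by ring)

theorem pderiv_comm [CommRing R] (i j : σ) (G : MvPolynomial σ R) :
    pderiv i (pderiv j G) = pderiv j (pderiv i G) := by
  classical
  have hbracket : ⁅pderiv (R := R) i, pderiv (R := R) j⁆ = 0 := by
    refine derivation_ext fun k => ?_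
    by_cases hj : j = k <;> by_cases hi : i = k <;>
      simp [Derivation.commutator_apply, pderiv_X, hi, hj]
  rw [← sub_eq_zero, ← Derivation.commutator_apply, hbracket, Derivation.coe_zero, Pi.zero_apply]

section
attribute [local instance] MvPolynomial.gradedAlgebra

theorem coe_decompose_eq_homogeneousComponent [CommSemiring R] (p : MvPolynomial σ R) (n : ℕ) :
    (DirectSum.decompose (homogeneousSubmodule σ R) p n : MvPolynomial σ R) =
      homogeneousComponent n p :=
  decomposition.decompose'_apply p n

theorem homogeneousComponent_mul_of_isHomogeneous [CommSemiring R] {p : MvPolynomial σ R} {m : ℕ}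
    (hp : p.IsHomogeneous m) (q : MvPolynomial σ R) (n : ℕ) :
    homogeneousComponent (m + n) (p * q) = p * homogeneousComponent n q := by
  simpa only [coe_decompose_eq_homogeneousComponent] using
    DirectSum.coe_decompose_mul_add_of_left_mem (homogeneousSubmodule σ R) (b := q) (j := n) hp

theorem homogeneousComponent_mul_of_lt [CommSemiring R] {p : MvPolynomial σ R} {m n : ℕ}
    (hp : p.IsHomogeneous m) (q : MvPolynomial σ R) (h : n < m) :
    homogeneousComponent n (p * q) = 0 := by
  simpa only [coe_decompose_eq_homogeneousComponent] using
    DirectSum.coe_decompose_mul_of_left_mem_of_not_le (homogeneousSubmodule σ R) (b := q) hp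
      (not_le.mpr h)

end

theorem eq_zero_of_dvd_of_lt [CommSemiring R] {p g : MvPolynomial σ R} {m d : ℕ}
    (hp : p.IsHomogeneous m) (hg : g.IsHomogeneous d) (h : p ∣ g) (hd : d < m) : g = 0 := by
  obtain ⟨q, rfl⟩ := h
  rw [← homogeneousComponent_eq_self hg, homogeneousComponent_mul_of_lt hp q hd]

theorem exists_isHomogeneous_mul_eq_of_dvd [CommSemiring R] {p g : MvPolynomial σ R} {m d : ℕ}
    (hp : p.IsHomogeneous m) (hg : g.IsHomogeneous d) (h : p ∣ g) :
    ∃ q : MvPolynomial σ R, q.IsHomogeneous (d - m) ∧ g = p * q := by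
  rcases lt_or_ge d m with hd | hd
  · exact ⟨0, isHomogeneous_zero _ _ _, by rw [mul_zero, eq_zero_of_dvd_of_lt hp hg h hd]⟩
  · obtain ⟨q, rfl⟩ := h
    refine ⟨homogeneousComponent (d - m) q, homogeneousComponent_isHomogeneous _ _, ?_⟩
    rw [← homogeneousComponent_mul_of_isHomogeneous hp, Nat.add_sub_cancel' hd,
      homogeneousComponent_eq_self hg]

theorem prime_of_isHomogeneous_one {K : Type*} [Field K] {p : MvPolynomial σ K}
    (hp : p.IsHomogeneous 1) (h0 : p ≠ 0) : Prime p := by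
  refine (irreducible_of_totalDegree_eq_one (hp.totalDegree h0) fun x hx => ?_).prime
  rw [isUnit_iff_ne_zero]
  rintro rfl
  exact h0 (MvPolynomial.ext _ _ fun m => by simpa using hx m)

end HomogeneousPolynomials

/-! ### Linear forms and coordinates -/

section LinearForms

variable {σ R A : Type*} [Fintype σ] [CommRing R]

/-- The linear form `∑ aᵢ Xᵢ` with coefficient vector `a`, as a linear function of `a`. -/
def linForm : (σ → R) →ₗ[R] MvPolynomial σ R := Fintype.linearCombination R X

theorem linForm_apply (a : σ → R) : linForm a = ∑ i, C (a i) * X i := by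
  simp [linForm, Fintype.linearCombination_apply, smul_eq_C_mul]

theorem isHomogeneous_linForm (a : σ → R) : (linForm a).IsHomogeneous 1 := by
  rw [linForm_apply]
  exact IsHomogeneous.sum _ _ _ fun _ _ => isHomogeneous_C_mul_X _ _

theorem aeval_linForm [CommRing A] [Algebra R A] (a : σ → R) (y : σ → A) :
    aeval y (linForm a) = ∑ i, a i • y i := by
  simp [linForm_apply, Algebra.smul_def]

theorem eval_linForm (a y : σ → R) : eval y (linForm a) = a ⬝ᵥ y :=
  aeval_linForm a y

theorem pderiv_linForm (a : σ → R) (i : σ) : pderiv i (linForm a) = C (a i) := by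
  classical
  simp [linForm_apply, pderiv_X, Pi.single_apply]

theorem linForm_injective : Function.Injective (linForm : (σ → R) →ₗ[R] MvPolynomial σ R) := by
  intro a b hab
  funext i
  simpa only [pderiv_linForm, C_inj] using congrArg (pderiv i) hab

theorem exists_linForm_eq {P : MvPolynomial σ R} (hP : P.IsHomogeneous 1) :
    ∃ a, linForm a = P := by
  rwa [← mem_homogeneousSubmodule, homogeneousSubmodule_one_eq_span_X,
    ← Fintype.range_linearCombination] at hP

/-- The linear form giving the `j`-th coordinate of a vector in the basis `b`. -/
def coordForm {ι : Type*} [DecidableEq σ] (b : Module.Basis ι R (σ → R)) (j : ι) :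
    MvPolynomial σ R :=
  linForm fun i => b.coord j (Pi.single i 1)

/-- The point with values in an algebra whose coordinates in the basis `b` are `c`. -/
def pointOfCoords {ι : Type*} [Fintype ι] [CommRing A] [Algebra R A]
    (b : Module.Basis ι R (σ → R)) (c : ι → A) : σ → A :=
  fun i => ∑ k, b k i • c k

variable {ι : Type*} [DecidableEq σ] (b : Module.Basis ι R (σ → R))

theorem eval_coordForm (j : ι) (y : σ → R) : eval y (coordForm b j) = b.coord j y := by
  rw [coordForm, eval_linForm, dotProduct]
  conv_rhs => rw [pi_eq_sum_univ' y, map_sum]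
  exact Finset.sum_congr rfl fun i _ => by rw [map_smul, smul_eq_mul, mul_comm]

theorem coordForm_ne_zero [Nontrivial R] (j : ι) : coordForm b j ≠ 0 := fun h => by
  simpa [h] using eval_coordForm b j (b j)

variable [Fintype ι]

theorem aeval_coordForm_pointOfCoords [CommRing A] [Algebra R A] (c : ι → A) (j : ι) :
    aeval (pointOfCoords b c) (coordForm b j) = c j := by
  classical
  have hdual (k : ι) : ∑ i, b.repr (Pi.single i 1) j * b k i = if k = j then 1 else 0 := by
    simpa only [coordForm, eval_linForm, dotProduct, Module.Basis.coord_apply,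
      Module.Basis.repr_self_apply] using eval_coordForm b j (b k)
  rw [coordForm, aeval_linForm]
  simp only [pointOfCoords, Finset.smul_sum, smul_smul]
  rw [Finset.sum_comm]
  simp [← Finset.sum_smul, hdual]

theorem X_eq_sum_coordForm (i : σ) : X i = ∑ j, C (b j i) * coordForm b j := by
  have hcoeff : ∑ j, b j i • (fun m => b.coord j (Pi.single m 1)) = Pi.single i 1 := by
    funext m
    have := congrFun (b.sum_repr (Pi.single m 1)) i
    simpa [mul_comm, Pi.single_apply, eq_comm] using this
  simp only [← smul_eq_C_mul, coordForm, ← map_smul, ← map_sum, hcoeff]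
  simp [linForm]

theorem isHomogeneous_one_eq_sum_coordForm {P : MvPolynomial σ R} (hP : P.IsHomogeneous 1) :
    P = ∑ j, C (eval (b j) P) * coordForm b j := by
  obtain ⟨a, rfl⟩ := exists_linForm_eq hP
  simp only [eval_linForm, dotProduct, map_sum, map_mul, Finset.sum_mul]
  rw [Finset.sum_comm, linForm_apply]
  refine Finset.sum_congr rfl fun i _ => ?_
  rw [X_eq_sum_coordForm b i, Finset.mul_sum]
  exact Finset.sum_congr rfl fun j _ => by ring

end LinearForms

/-! ### Rational parametrizations -/

section Homogenization

variable {R A : Type*} [CommRing R] [IsDomain R] [CommRing A] [Algebra R A]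

theorem aeval_homogenize_X_sub_C_pow (a b : A) (t : R) (n : ℕ) :
    aeval ![a, b] (((Polynomial.X - Polynomial.C t) ^ n).homogenize n) = (a - t • b) ^ n := by
  induction n with
  | zero => simp
  | succ n ih =>
    rw [pow_succ, Polynomial.homogenize_mul _ _ (by simp) (Polynomial.natDegree_X_sub_C_le t),
      map_mul, ih, pow_succ]
    simp [Algebra.smul_def]

theorem pow_dvd_aeval_homogenize (a b : A) {t : R} {n m : ℕ} {p : R[X]} (hp : p.natDegree ≤ m)
    (h : (Polynomial.X - Polynomial.C t) ^ n ∣ p) :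
    (a - t • b) ^ n ∣ aeval ![a, b] (p.homogenize m) := by
  obtain ⟨q, rfl⟩ := h
  rcases eq_or_ne q 0 with rfl | hq
  · simp
  rw [Polynomial.natDegree_mul (pow_ne_zero _ (Polynomial.X_sub_C_ne_zero t)) hq,
    Polynomial.natDegree_pow, Polynomial.natDegree_X_sub_C, mul_one] at hp
  obtain ⟨k, rfl⟩ := Nat.exists_eq_add_of_le (le_of_add_le_left hp)
  rw [Polynomial.homogenize_mul _ _ (by simp) (by omega), map_mul, aeval_homogenize_X_sub_C_pow]
  exact dvd_mul_right _ _

end Homogenization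

section RationalParam

variable {σ K : Type*} [Field K]

/-- A parametrization, by polynomials of degree at most `e`, of the hypersurface `P = 0` minus one
point. Its inverse is `y ↦ num y / den y`, where the linear form `den` vanishes on `P = 0` only at
the missing point, whose coordinates are the coefficients of degree `e`. -/
structure RationalParam (P : MvPolynomial σ K) (e : ℕ) where
  coord : σ → K[X]
  den : MvPolynomial σ K
  num : MvPolynomial σ K
  natDegree_coord_le : ∀ i, (coord i).natDegree ≤ e
  aeval_coord_self : aeval coord P = 0
  isHomogeneous_den : den.IsHomogeneous 1
  isHomogeneous_num : num.IsHomogeneous 1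
  isRelPrime_den : IsRelPrime P den
  aeval_coord_den : aeval coord den = 1
  aeval_coord_num : aeval coord num = Polynomial.X
  dvd_den_pow_mul_X_sub : ∀ i,
    P ∣ den ^ e * X i - den * aeval ![num, den] ((coord i).homogenize e)
  coeff_ne_zero : (fun i => (coord i).coeff e) ≠ 0
  exists_eq_smul_coeff : ∀ y, eval y P = 0 → eval y den = 0 →
    ∃ c : K, y = c • fun i => (coord i).coeff e

namespace RationalParam

variable {P G : MvPolynomial σ K} {e d : ℕ} (φ : RationalParam P e)

/-- The point with parameter `t`. -/
def point (t : K) : σ → K := fun i => (φ.coord i).eval t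

/-- The point missed by the parametrization. -/
def infinity : σ → K := fun i => (φ.coord i).coeff e

theorem eval_point (G : MvPolynomial σ K) (t : K) :
    eval (φ.point t) G = (aeval φ.coord G).eval t :=
  (eval_aeval_polynomial _ _ _).symm

theorem eval_infinity (hG : G.IsHomogeneous d) :
    eval φ.infinity G = (aeval φ.coord G).coeff (e * d) :=
  (coeff_aeval φ.natDegree_coord_le hG).symm

theorem eval_point_self (t : K) : eval (φ.point t) P = 0 := by
  rw [eval_point, aeval_coord_self, Polynomial.eval_zero]

theorem eval_point_den (t : K) : eval (φ.point t) φ.den = 1 := by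
  rw [eval_point, aeval_coord_den, Polynomial.eval_one]

theorem eval_point_num (t : K) : eval (φ.point t) φ.num = t := by
  rw [eval_point, aeval_coord_num, Polynomial.eval_X]

theorem eq_one_of_point_eq_smul {t t' c : K} (h : φ.point t = c • φ.point t') : c = 1 := by
  simpa [h, eval_smul_of_isHomogeneous φ.isHomogeneous_den, eval_point_den] using
    φ.eval_point_den t

theorem eq_of_point_eq_smul {t t' c : K} (h : φ.point t = c • φ.point t') : t = t' := by
  rw [φ.eq_one_of_point_eq_smul h, one_smul] at h
  rw [← φ.eval_point_num t, h, eval_point_num]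

theorem point_ne_zero (t : K) : φ.point t ≠ 0 := fun h => by
  have hden := eval_smul_of_isHomogeneous φ.isHomogeneous_den 0 (φ.point t)
  rw [zero_smul, ← h, eval_point_den] at hden
  simp at hden

theorem dvd_den_pow_mul_sub (hG : G.IsHomogeneous d) :
    P ∣ φ.den ^ (e * d) * G -
      φ.den ^ d * aeval ![φ.num, φ.den] ((aeval φ.coord G).homogenize (e * d)) := by
  have h := dvd_aeval_sub_aeval φ.dvd_den_pow_mul_X_sub G
  have hX := aeval_smul_of_isHomogeneous hG (φ.den ^ e) X
  have hΦ := aeval_smul_of_isHomogeneous hG φ.den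
    fun i => aeval ![φ.num, φ.den] ((φ.coord i).homogenize e)
  rw [aeval_X_left_apply, ← pow_mul] at hX
  rw [← comp_aeval_apply, ← homogenize_aeval φ.natDegree_coord_le hG] at hΦ
  rwa [← hX, ← hΦ]

theorem dvd_of_aeval_coord_eq_zero (hG : G.IsHomogeneous d) (h : aeval φ.coord G = 0) : P ∣ G := by
  have := φ.dvd_den_pow_mul_sub hG
  rw [h, Polynomial.homogenize_zero, map_zero, mul_zero, sub_zero] at this
  exact φ.isRelPrime_den.pow_right.dvd_of_dvd_mul_left this

theorem aeval_coord_eq_zero_iff (hG : G.IsHomogeneous d) : aeval φ.coord G = 0 ↔ P ∣ G := by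
  refine ⟨φ.dvd_of_aeval_coord_eq_zero hG, fun ⟨q, hq⟩ => ?_⟩
  rw [hq, map_mul, aeval_coord_self, zero_mul]

theorem exists_dvd_den_pow_mul_sub {n : ℕ} {t : K} (hG : G.IsHomogeneous d)
    (h : (Polynomial.X - Polynomial.C t) ^ n ∣ aeval φ.coord G) :
    ∃ (N : ℕ) (H : MvPolynomial σ K),
      P ∣ φ.den ^ N * G - (φ.num - t • φ.den) ^ n * H := by
  obtain ⟨q, hq⟩ := pow_dvd_aeval_homogenize φ.num φ.den
    (natDegree_aeval_le φ.natDegree_coord_le hG) h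
  refine ⟨e * d, φ.den ^ d * q, ?_⟩
  rw [mul_left_comm, ← hq]
  exact φ.dvd_den_pow_mul_sub hG

theorem eq_smul_point_or_eq_smul_infinity {y : σ → K} (hy : eval y P = 0) :
    (∃ t c : K, y = c • φ.point t) ∨ ∃ c : K, y = c • φ.infinity := by
  by_cases hden : eval y φ.den = 0
  · exact Or.inr (φ.exists_eq_smul_coeff y hy hden)
  refine Or.inl ⟨eval y φ.num / eval y φ.den, eval y φ.den, _root_.funext fun i => ?_⟩
  obtain ⟨q, hq⟩ := φ.dvd_den_pow_mul_X_sub i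
  have hvals : (fun j => eval y (![φ.num, φ.den] j)) = ![eval y φ.num, eval y φ.den] := by
    ext j
    fin_cases j <;> rfl
  have hi := congrArg (eval y) hq
  simp only [map_mul, hy, zero_mul, map_sub, map_pow, eval_X, eval_aeval_mvPolynomial, hvals,
    Polynomial.eval_homogenize (φ.natDegree_coord_le i) ![eval y φ.num, eval y φ.den] hden,
    Matrix.cons_val_zero, Matrix.cons_val_one] at hi
  refine mul_left_cancel₀ (pow_ne_zero e hden) ?_
  simp only [Pi.smul_apply, smul_eq_mul, point]
  linear_combination hi

theorem prime (φ : RationalParam P e) (hP : P.IsHomogeneous d) (h0 : P ≠ 0) : Prime P := by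
  let := gradedAlgebra (σ := σ) (R := K)
  rw [← Ideal.span_singleton_prime h0]
  refine Ideal.IsHomogeneous.isPrime_of_homogeneous_mem_or_mem
    (𝒜 := homogeneousSubmodule σ K) (Ideal.homogeneous_span _ _ ?_) ?_ ?_
  · rintro _ rfl
    exact ⟨d, hP⟩
  · rw [Ne, Ideal.span_singleton_eq_top]
    intro hunit
    simpa [eval_point_self] using hunit.map (eval (φ.point 0))
  · rintro x y ⟨m, hx⟩ ⟨n, hy⟩ hxy
    simp only [Ideal.mem_span_singleton] at hxy ⊢
    rw [← φ.aeval_coord_eq_zero_iff hx, ← φ.aeval_coord_eq_zero_iff hy, ← mul_eq_zero, ← map_mul]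
    exact (φ.aeval_coord_eq_zero_iff (hx.mul hy)).mpr hxy

theorem exists_isHomogeneous_aeval_coord_eq {q : K[X]} (hq : q.natDegree ≤ d) :
    ∃ G : MvPolynomial σ K, G.IsHomogeneous d ∧ aeval φ.coord G = q := by
  have hlin (j : Fin 2) : (![φ.num, φ.den] j).IsHomogeneous 1 :=
    Fin.cases φ.isHomogeneous_num (Fin.cases φ.isHomogeneous_den fun j => j.elim0) j
  have hvals : (fun j => aeval φ.coord (![φ.num, φ.den] j)) = ![Polynomial.X, 1] := by
    ext1 j
    fin_cases j
    · exact φ.aeval_coord_num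
    · exact φ.aeval_coord_den
  refine ⟨aeval ![φ.num, φ.den] (q.homogenize d), ?_, ?_⟩
  · simpa using (Polynomial.isHomogeneous_homogenize q).aeval _ hlin
  · rw [← AlgHom.comp_apply, comp_aeval, hvals, Polynomial.aeval_homogenize_X_one _ hq]

theorem exists_forall_eval_point_ne_zero [Infinite K] {ι : Type*} (s : Finset ι)
    {Z : ι → MvPolynomial σ K} {δ : ι → ℕ} (hZ : ∀ j, (Z j).IsHomogeneous (δ j))
    (hdvd : ∀ j ∈ s, ¬ P ∣ Z j) : ∃ t, ∀ j ∈ s, eval (φ.point t) (Z j) ≠ 0 := by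
  have h0 : ∏ j ∈ s, aeval φ.coord (Z j) ≠ 0 := Finset.prod_ne_zero_iff.mpr fun j hj h =>
    hdvd j hj (φ.dvd_of_aeval_coord_eq_zero (hZ j) h)
  obtain ⟨t, ht⟩ : ∃ t, (∏ j ∈ s, aeval φ.coord (Z j)).eval t ≠ 0 := by
    by_contra! h
    exact h0 (Polynomial.funext fun t => by simp [h t])
  rw [Polynomial.eval_prod, Finset.prod_ne_zero_iff] at ht
  exact ⟨t, fun j hj => by rw [eval_point]; exact ht j hj⟩

end RationalParam

end RationalParam

section LinesAndConics

variable {σ K : Type*} [Field K]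

theorem isRelPrime_of_eval {P u : MvPolynomial σ K} (hu : u.IsHomogeneous 1) (hu0 : u ≠ 0)
    {y : σ → K} (hy : eval y u = 0) (hPy : eval y P ≠ 0) : IsRelPrime P u := by
  refine ((prime_of_isHomogeneous_one hu hu0).irreducible.isRelPrime_iff_not_dvd.mpr ?_).symm
  rintro ⟨q, rfl⟩
  simp [hy] at hPy

variable [Fintype σ] [DecidableEq σ] {ι : Type*} [Fintype ι]

theorem dvd_mul_X_sub_homogenize_pointOfCoords {P N D : MvPolynomial σ K} {e : ℕ}
    {u : Fin 2 → MvPolynomial σ K} {b : Module.Basis ι K (σ → K)} {c : ι → K[X]}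
    (h : ∀ k, P ∣ N * coordForm b k - D * aeval u ((c k).homogenize e)) (i : σ) :
    P ∣ N * X i - D * aeval u ((pointOfCoords b c i).homogenize e) := by
  have hlin : aeval u ((pointOfCoords b c i).homogenize e) =
      ∑ k, C (b k i) * aeval u ((c k).homogenize e) := by
    simp only [pointOfCoords, Polynomial.homogenize_finsetSum, Polynomial.homogenize_smul, map_sum,
      map_smul, ← smul_eq_C_mul]
  have hsum : N * X i - D * aeval u ((pointOfCoords b c i).homogenize e) =
      ∑ k, C (b k i) * (N * coordForm b k - D * aeval u ((c k).homogenize e)) := by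
    rw [hlin, X_eq_sum_coordForm b i, Finset.mul_sum, Finset.mul_sum, ← Finset.sum_sub_distrib]
    exact Finset.sum_congr rfl fun k _ => by ring
  rw [hsum]
  exact Finset.dvd_sum fun k _ => (h k).mul_left _

theorem exists_rationalParam_of_basis {P : MvPolynomial σ K} {e : ℕ}
    (b : Module.Basis ι K (σ → K)) {c : ι → K[X]} {j₀ j₁ : ι}
    (hdeg : ∀ k, (c k).natDegree ≤ e) (hP : aeval (pointOfCoords b c) P = 0)
    (hc₀ : c j₀ = Polynomial.X) (hc₁ : c j₁ = 1) (hrel : IsRelPrime P (coordForm b j₁))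
    (hdvd : ∀ k, P ∣ coordForm b j₁ ^ e * coordForm b k -
      coordForm b j₁ * aeval ![coordForm b j₀, coordForm b j₁] ((c k).homogenize e))
    (hne : ∃ k, (c k).coeff e ≠ 0)
    (hinf : ∀ y, eval y P = 0 → eval y (coordForm b j₁) = 0 →
      ∃ r : K, y = r • ∑ k, (c k).coeff e • b k) :
    ∃ φ : RationalParam P e, φ.infinity = ∑ k, (c k).coeff e • b k := by
  have hcoeff : (fun i => (pointOfCoords b c i).coeff e) = ∑ k, (c k).coeff e • b k := by
    funext i
    simp [pointOfCoords, Polynomial.finsetSum_coeff, mul_comm]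
  obtain ⟨k, hk⟩ := hne
  exact ⟨{
    coord := pointOfCoords b c
    den := coordForm b j₁
    num := coordForm b j₀
    natDegree_coord_le := fun i => Polynomial.natDegree_sum_le_of_forall_le _ _ fun k _ =>
      (Polynomial.natDegree_smul_le _ _).trans (hdeg k)
    aeval_coord_self := hP
    isHomogeneous_den := isHomogeneous_linForm _
    isHomogeneous_num := isHomogeneous_linForm _
    isRelPrime_den := hrel
    aeval_coord_den := (aeval_coordForm_pointOfCoords b c j₁).trans hc₁
    aeval_coord_num := (aeval_coordForm_pointOfCoords b c j₀).trans hc₀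
    dvd_den_pow_mul_X_sub := dvd_mul_X_sub_homogenize_pointOfCoords hdvd
    coeff_ne_zero := fun h =>
      hk (Fintype.linearIndependent_iff.mp b.linearIndependent _ (hcoeff.symm.trans h) k)
    exists_eq_smul_coeff := fun y hy hden => hcoeff ▸ hinf y hy hden }, hcoeff⟩

theorem exists_basis_of_mem_ker {V : Type*} [AddCommGroup V] [Module K V]
    (hV : Module.finrank K V = 3) {f : V →ₗ[K] K} (hf : f ≠ 0) {q : V} (hq : q ≠ 0)
    (hfq : f q = 0) :
    ∃ b : Module.Basis (Fin 3) K V, f (b 0) = 1 ∧ b 1 = q ∧ f (b 2) = 0 := by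
  have : FiniteDimensional K V := .of_finrank_pos (by omega)
  obtain ⟨p, hp⟩ := LinearMap.surjective hf 1
  have hker : Module.finrank K f.ker = 2 := by
    have := f.finrank_range_add_finrank_ker
    rw [LinearMap.range_eq_top.mpr (LinearMap.surjective hf), finrank_top,
      Module.finrank_self] at this
    omega
  obtain ⟨⟨r, hr⟩, hli⟩ := exists_linearIndependent_pair_of_one_lt_finrank
    (hker.symm ▸ one_lt_two) (x := (⟨q, hfq⟩ : f.ker)) (by simpa [← Subtype.coe_ne_coe] using hq)
  have hqr : LinearIndependent K ![q, r] :=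
    LinearIndependent.pair_iff.mpr fun s t hst =>
      LinearIndependent.pair_iff.mp hli s t (Subtype.ext hst)
  have hspan : Submodule.span K (Set.range ![q, r]) ≤ f.ker := by
    rw [Submodule.span_le, Matrix.range_cons, Matrix.range_cons, Matrix.range_empty]
    rintro x (rfl | rfl | hx)
    exacts [hfq, hr, hx.elim]
  have hpqr : LinearIndependent K ![p, q, r] := linearIndependent_finCons.mpr
    ⟨hqr, fun h => one_ne_zero (hp.symm.trans (hspan h))⟩
  refine ⟨basisOfLinearIndependentOfCardEqFinrank hpqr (by simp [hV]), ?_⟩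
  simpa [hp] using hr

variable {P : MvPolynomial (Fin 3) K}

theorem exists_rationalParam_coordForm (b : Module.Basis (Fin 3) K (Fin 3 → K)) :
    ∃ φ : RationalParam (coordForm b 0) 1, φ.infinity = b 1 := by
  have hinf : ∑ k, (![0, Polynomial.X, 1] k : K[X]).coeff 1 • b k = b 1 := by
    simp [Fin.sum_univ_three, Polynomial.coeff_one]
  rw [← hinf]
  refine exists_rationalParam_of_basis b (j₀ := 1) (j₁ := 2) ?_ ?_ rfl rfl ?_ ?_ ⟨1, by simp⟩ ?_
  · simp [Fin.forall_fin_succ]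
  · exact aeval_coordForm_pointOfCoords _ _ _
  · refine isRelPrime_of_eval (isHomogeneous_linForm _) (coordForm_ne_zero b 2) (y := b 0) ?_ ?_ <;>
      simp [eval_coordForm]
  · simp [Fin.forall_fin_succ, Polynomial.homogenize_X, mul_comm]
  · intro y h0 h2
    refine ⟨eval y (coordForm b 1), ?_⟩
    rw [eval_coordForm, Module.Basis.coord_apply] at h0 h2
    rw [hinf, eval_coordForm]
    exact (b.sum_repr y).symm.trans (by simp [Fin.sum_univ_three, h0, h2, -Module.Basis.sum_repr])

theorem exists_rationalParam_coordForm_mul_sub_sq (b : Module.Basis (Fin 3) K (Fin 3 → K)) :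
    ∃ φ : RationalParam (coordForm b 0 * coordForm b 2 - coordForm b 1 ^ 2) 2,
      φ.infinity = b 0 := by
  have hinf : ∑ k, (![Polynomial.X ^ 2, Polynomial.X, 1] k : K[X]).coeff 2 • b k = b 0 := by
    simp [Fin.sum_univ_three, Polynomial.coeff_one, Polynomial.coeff_X]
  rw [← hinf]
  refine exists_rationalParam_of_basis b (j₀ := 1) (j₁ := 2) ?_ ?_ rfl rfl ?_ ?_ ⟨0, by simp⟩ ?_
  · simp [Fin.forall_fin_succ]
  · simp [aeval_coordForm_pointOfCoords]
  · refine isRelPrime_of_eval (isHomogeneous_linForm _) (coordForm_ne_zero b 2) (y := b 1) ?_ ?_ <;>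
      simp [eval_coordForm]
  · simp only [Fin.forall_fin_succ, IsEmpty.forall_iff, and_true]
    refine ⟨?_, ?_, ?_⟩
    · refine ⟨coordForm b 2, ?_⟩
      simp only [aeval_eq_bind₁, Matrix.cons_val_zero, le_refl, Polynomial.homogenize_X_pow,
        tsub_self, pow_zero, mul_one, map_pow, bind₁_X_right]
      ring
    · simp only [aeval_eq_bind₁, Fin.succ_zero_eq_one, Matrix.cons_val_one, Matrix.cons_val_zero,
        ne_eq, OfNat.ofNat_ne_zero, not_false_eq_true, Polynomial.homogenize_X,
        Nat.add_one_sub_one, pow_one, map_mul, bind₁_X_right, Matrix.cons_val_fin_one]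
      exact ⟨0, by ring⟩
    · simp only [aeval_eq_bind₁, Fin.succ_zero_eq_one, Fin.succ_one_eq_two, Matrix.cons_val,
        Polynomial.homogenize_one, map_pow, bind₁_X_right, Matrix.cons_val_one,
        Matrix.cons_val_fin_one]
      exact ⟨0, by ring⟩
  · intro y hP h2
    have h1 : eval y (coordForm b 1) = 0 := by simpa [h2] using hP
    rw [eval_coordForm, Module.Basis.coord_apply] at h1 h2
    refine ⟨eval y (coordForm b 0), ?_⟩
    rw [hinf, eval_coordForm]
    exact (b.sum_repr y).symm.trans (by simp [Fin.sum_univ_three, h1, h2, -Module.Basis.sum_repr])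

theorem exists_rationalParam_line (hP : P.IsHomogeneous 1) (h0 : P ≠ 0) {q : Fin 3 → K}
    (hq : q ≠ 0) (hPq : eval q P = 0) : ∃ φ : RationalParam P 1, φ.infinity = q := by
  obtain ⟨a, rfl⟩ := exists_linForm_eq hP
  have ha : a ≠ 0 := by
    rintro rfl
    exact h0 (map_zero _)
  rw [eval_linForm] at hPq
  obtain ⟨b, hb₀, rfl, hb₂⟩ := exists_basis_of_mem_ker (f := dotProductEquiv K (Fin 3) a)
    (by simp) (by simpa using ha) hq hPq
  rw [dotProductEquiv_apply_apply] at hb₀ hb₂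
  have hcoord : linForm a = coordForm b 0 := by
    rw [isHomogeneous_one_eq_sum_coordForm b hP]
    simp [Fin.sum_univ_three, eval_linForm, hb₀, hPq, hb₂]
  rw [hcoord]
  exact exists_rationalParam_coordForm b

/-- The bilinear form on `K^σ` whose Gram matrix is the Hessian matrix of `P`, for a quadratic
form `P`. -/
def hessianForm (P : MvPolynomial σ K) : LinearMap.BilinForm K (σ → K) :=
  Matrix.toBilin' (Matrix.of fun i j => constantCoeff (pderiv j (pderiv i P)))

theorem hessianForm_isSymm (P : MvPolynomial σ K) : (hessianForm P).IsSymm := by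
  refine ⟨fun v w => ?_⟩
  simp only [hessianForm, Matrix.toBilin'_apply, Matrix.of_apply]
  rw [Finset.sum_comm]
  refine Finset.sum_congr rfl fun i _ => Finset.sum_congr rfl fun j _ => ?_
  rw [pderiv_comm]
  ring

theorem hessianForm_single {P : MvPolynomial σ K} (hP : P.IsHomogeneous 2) (i : σ) (w : σ → K) :
    hessianForm P (Pi.single i 1) w = eval w (pderiv i P) := by
  obtain ⟨a, ha⟩ := exists_linForm_eq (hP.pderiv (i := i))
  simp [hessianForm, Matrix.toBilin'_apply, Pi.single_apply, ← ha, pderiv_linForm, eval_linForm,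
    dotProduct]

theorem hessianForm_apply {P : MvPolynomial σ K} (hP : P.IsHomogeneous 2) (v w : σ → K) :
    hessianForm P v w = ∑ i, v i * eval w (pderiv i P) := by
  conv_lhs => rw [pi_eq_sum_univ' v]
  simp only [map_sum, map_smul, LinearMap.sum_apply, LinearMap.smul_apply, hessianForm_single hP,
    smul_eq_mul]

theorem hessianForm_self {P : MvPolynomial σ K} (hP : P.IsHomogeneous 2) (v : σ → K) :
    hessianForm P v v = 2 * eval v P := by
  simpa [hessianForm_apply hP] using congrArg (eval v) hP.sum_X_mul_pderiv

theorem two_mul_eq_sum_hessianForm {P : MvPolynomial σ K} (hP : P.IsHomogeneous 2)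
    (b : Module.Basis ι K (σ → K)) :
    2 * P = ∑ j, ∑ k, C (hessianForm P (b j) (b k)) * (coordForm b j * coordForm b k) := by
  have hEuler : 2 * P = ∑ i, X i * pderiv i P := by
    simpa using hP.sum_X_mul_pderiv.symm
  have hgrad (i : σ) : X i * pderiv i P = ∑ j, ∑ k,
      C (b j i * eval (b k) (pderiv i P)) * (coordForm b j * coordForm b k) := by
    rw [X_eq_sum_coordForm b i, isHomogeneous_one_eq_sum_coordForm b (hP.pderiv (i := i)),
      Finset.sum_mul_sum]
    refine Finset.sum_congr rfl fun j _ => Finset.sum_congr rfl fun k _ => ?_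
    rw [← isHomogeneous_one_eq_sum_coordForm b hP.pderiv, map_mul]
    ring
  simp only [hEuler, hgrad, hessianForm_apply hP, map_sum, Finset.sum_mul]
  rw [Finset.sum_comm]
  exact Finset.sum_congr rfl fun j _ => Finset.sum_comm

theorem exists_isotropic_dual_vector {V : Type*} [AddCommGroup V] [Module K V]
    {B : LinearMap.BilinForm K V} (hB : B.IsSymm) (h2 : (2 : K) ≠ 0) {q w : V}
    (hqq : B q q = 0) (hqw : B q w = 1) : ∃ w', B q w' = 1 ∧ B w' w' = 0 := by
  refine ⟨w - (B w w / 2) • q, by simp [hqq, hqw], ?_⟩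
  have hwq : B w q = 1 := (hB.eq w q).trans hqw
  simp only [map_sub, map_smul, LinearMap.sub_apply, LinearMap.smul_apply, smul_eq_mul, hqq, hqw,
    hwq]
  field_simp
  ring

theorem linearIndependent_of_isotropic_pair {V : Type*} [AddCommGroup V] [Module K V]
    {B : LinearMap.BilinForm K V} (hB : B.IsSymm) {q u w : V} (hqq : B q q = 0) (hww : B w w = 0)
    (hqw : B q w = 1) (hqu : B q u = 0) (hwu : B w u = 0) (hu : u ≠ 0) :
    LinearIndependent K ![q, u, w] := by
  have hwq : B w q = 1 := (hB.eq w q).trans hqw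
  rw [Fintype.linearIndependent_iff]
  intro g hg
  simp only [Fin.sum_univ_three, Matrix.cons_val] at hg
  have h2 : g 2 = 0 := by simpa [hqq, hqw, hqu] using congrArg (B q) hg
  have h0 : g 0 = 0 := by simpa [hww, hwq, hwu] using congrArg (B w) hg
  have h1 : g 1 = 0 := by simpa [h0, h2, hu] using hg
  exact Fin.forall_fin_succ.mpr ⟨h0, by simp [Fin.forall_fin_succ, h1, h2]⟩

theorem exists_basis_of_isotropic [IsAlgClosed K] (h2 : (2 : K) ≠ 0) {V : Type*} [AddCommGroup V]
    [Module K V] (hV : Module.finrank K V = 3) {B : LinearMap.BilinForm K V} (hB : B.IsSymm)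
    (hBker : ∀ v, (∀ w, B v w = 0) → v = 0) {q : V} (hq : q ≠ 0) (hqq : B q q = 0) :
    ∃ b : Module.Basis (Fin 3) K V, b 0 = q ∧
      ∀ i j, B (b i) (b j) = !![0, 0, 1; 0, -2, 0; 1, 0, 0] i j := by
  have : FiniteDimensional K V := .of_finrank_pos (by omega)
  have hcomm (x y : V) : B x y = B y x := hB.eq x y
  obtain ⟨w, hqw, hww⟩ : ∃ w, B q w = 1 ∧ B w w = 0 := by
    obtain ⟨w, hw⟩ := LinearMap.surjective (f := B q)
      (fun h => hq (hBker q fun w => LinearMap.congr_fun h w)) 1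
    exact exists_isotropic_dual_vector hB h2 hqq hw
  obtain ⟨u, hu, hu0⟩ := Submodule.exists_mem_ne_zero_of_ne_bot
    (LinearMap.ker_ne_bot_of_finrank_lt (f := (B q).prod (B w)) (by simp [hV]))
  obtain ⟨hqu, hwu⟩ : B q u = 0 ∧ B w u = 0 := by simpa using hu
  have huu : B u u ≠ 0 := fun h => by
    let b := basisOfLinearIndependentOfCardEqFinrank
      (linearIndependent_of_isotropic_pair hB hqq hww hqw hqu hwu hu0) (by simp [hV])
    have hBu : B u = 0 := b.ext (by simp [b, Fin.forall_fin_succ, hcomm u, hqu, hwu, h])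
    exact hu0 (hBker u (LinearMap.congr_fun hBu))
  obtain ⟨s, hs⟩ := IsAlgClosed.exists_pow_nat_eq (-2 / B u u) two_pos
  have hs0 : s ≠ 0 := by
    rintro rfl
    simpa [huu, h2] using hs.symm
  have hsu : s * (s * B u u) = -2 := by
    rw [← mul_assoc, ← sq, hs, div_mul_cancel₀ _ huu]
  refine ⟨basisOfLinearIndependentOfCardEqFinrank (linearIndependent_of_isotropic_pair hB hqq hww
    hqw (u := s • u) (by simp [hqu]) (by simp [hwu]) (smul_ne_zero hs0 hu0)) (by simp [hV]), ?_⟩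
  simp [Fin.forall_fin_succ, hqq, hww, hqw, hcomm w q, hqu, hwu, hcomm u, hsu]

theorem exists_rationalParam_conic [IsAlgClosed K] (h2 : (2 : K) ≠ 0) (hP : P.IsHomogeneous 2)
    (hsmooth : ∀ v, (∀ i, eval v (pderiv i P) = 0) → v = 0) {q : Fin 3 → K}
    (hq : q ≠ 0) (hPq : eval q P = 0) : ∃ φ : RationalParam P 2, φ.infinity = q := by
  have hB := hessianForm_isSymm P
  obtain ⟨b, rfl, hb⟩ := exists_basis_of_isotropic h2 (by simp) hB
    (fun v hv => hsmooth v fun i => by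
      rw [← hessianForm_single hP, ← hv (Pi.single i 1)]
      exact hB.eq _ _)
    hq (by rw [hessianForm_self hP, hPq, mul_zero])
  have hcoord : P = coordForm b 0 * coordForm b 2 - coordForm b 1 ^ 2 := by
    refine mul_left_cancel₀ (C_ne_zero.mpr h2) ?_
    rw [map_ofNat, two_mul_eq_sum_hessianForm hP b]
    simp only [Fin.sum_univ_three, hb, Matrix.of_apply, Matrix.cons_val, map_zero, map_one, map_neg,
      map_ofNat]
    ring
  rw [hcoord]
  exact exists_rationalParam_coordForm_mul_sub_sq b

theorem exists_ne_zero_eval_eq_zero [IsAlgClosed K] {d : ℕ} (hP : P.IsHomogeneous d) (hd : d ≠ 0) :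
    ∃ q ≠ 0, eval q P = 0 := by
  have hdeg (i : Fin 3) : (![Polynomial.X, 1, 0] i : K[X]).natDegree ≤ 1 := by
    fin_cases i <;> simp
  by_cases hlead : (aeval ![Polynomial.X, 1, 0] P : K[X]).coeff (1 * d) = 0
  · rw [coeff_aeval hdeg hP] at hlead
    refine ⟨_, fun h0 => ?_, hlead⟩
    simpa using congrFun h0 0
  · have hpos := Polynomial.le_degree_of_ne_zero hlead
    obtain ⟨t, ht⟩ := IsAlgClosed.exists_root (aeval ![Polynomial.X, 1, 0] P : K[X]) fun h => by
      simp [h, hd] at hpos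
    refine ⟨_, fun h0 => ?_, (eval_aeval_polynomial _ _ _).symm.trans ht⟩
    simpa using congrFun h0 1

/-- When every point of the curve can be made the point missed by a parametrization, the missed
point can be moved off finitely many other curves. -/
theorem exists_rationalParam_eval_infinity_ne_zero [IsAlgClosed K] {e : ℕ}
    (hP : P.IsHomogeneous e) (he : e ≠ 0)
    (hparam : ∀ q ≠ 0, eval q P = 0 → ∃ φ : RationalParam P e, φ.infinity = q) {ι : Type*}
    (s : Finset ι) {Z : ι → MvPolynomial (Fin 3) K} {δ : ι → ℕ}
    (hZ : ∀ j, (Z j).IsHomogeneous (δ j)) (hdvd : ∀ j ∈ s, ¬ P ∣ Z j) :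
    ∃ φ : RationalParam P e, ∀ j ∈ s, eval φ.infinity (Z j) ≠ 0 := by
  obtain ⟨q, hq, hPq⟩ := exists_ne_zero_eval_eq_zero hP he
  obtain ⟨φ, -⟩ := hparam q hq hPq
  obtain ⟨t, ht⟩ := φ.exists_forall_eval_point_ne_zero s hZ hdvd
  obtain ⟨ψ, hψ⟩ := hparam (φ.point t) (φ.point_ne_zero t) (φ.eval_point_self t)
  exact ⟨ψ, hψ ▸ ht⟩

end LinesAndConics

/-! ### Intersection multiplicities at nodes, tacnodes and ordinary triple points -/

section Bicoeff

variable {K : Type*}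

/-- The coefficient of `xⁱ yʲ` in a power series in two variables. -/
def bicoeff [Semiring K] (i j : ℕ) (p : MvPowerSeries (Fin 2) K) : K :=
  MvPowerSeries.coeff (Finsupp.single 0 i + Finsupp.single 1 j) p

theorem bicoeff_zero_zero [Semiring K] (p : MvPowerSeries (Fin 2) K) :
    bicoeff 0 0 p = MvPowerSeries.constantCoeff p := by
  simp [bicoeff]

theorem bicoeff_add [Semiring K] (i j : ℕ) (p q : MvPowerSeries (Fin 2) K) :
    bicoeff i j (p + q) = bicoeff i j p + bicoeff i j q :=
  map_add _ _ _

theorem bicoeff_sub [Ring K] (i j : ℕ) (p q : MvPowerSeries (Fin 2) K) :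
    bicoeff i j (p - q) = bicoeff i j p - bicoeff i j q :=
  map_sub _ _ _

theorem bicoeff_X_zero [Semiring K] (i j : ℕ) :
    bicoeff i j (MvPowerSeries.X 0 : MvPowerSeries (Fin 2) K) = if i = 1 ∧ j = 0 then 1 else 0 := by
  classical
  rw [bicoeff, MvPowerSeries.coeff_X]
  refine if_congr ?_ rfl rfl
  simp [DFunLike.ext_iff, Fin.forall_fin_two]

theorem bicoeff_X_one [Semiring K] (i j : ℕ) :
    bicoeff i j (MvPowerSeries.X 1 : MvPowerSeries (Fin 2) K) = if i = 0 ∧ j = 1 then 1 else 0 := by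
  classical
  rw [bicoeff, MvPowerSeries.coeff_X]
  refine if_congr ?_ rfl rfl
  simp [DFunLike.ext_iff, Fin.forall_fin_two]

open Finset.HasAntidiagonal (antidiagonal) in
theorem bicoeff_mul [Semiring K] (i j : ℕ) (p q : MvPowerSeries (Fin 2) K) :
    bicoeff i j (p * q) = ∑ a ∈ Finset.range (i + 1), ∑ b ∈ Finset.range (j + 1),
      bicoeff a b p * bicoeff (i - a) (j - b) q := by
  classical
  have hsum : bicoeff i j (p * q) = ∑ a ∈ antidiagonal i, ∑ b ∈ antidiagonal j,
      bicoeff a.1 b.1 p * bicoeff a.2 b.2 q := by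
    rw [bicoeff, MvPowerSeries.coeff_mul, ← Finset.sum_product']
    refine Finset.sum_nbij' (fun x => ((x.1 0, x.2 0), (x.1 1, x.2 1)))
      (fun y => (Finsupp.single 0 y.1.1 + Finsupp.single 1 y.2.1,
        Finsupp.single 0 y.1.2 + Finsupp.single 1 y.2.2)) ?_ ?_ ?_ ?_ ?_
    · simp +contextual [DFunLike.ext_iff, Fin.forall_fin_two]
    · simp +contextual [DFunLike.ext_iff, Fin.forall_fin_two]
    · simp [Prod.ext_iff, DFunLike.ext_iff, Fin.forall_fin_two]
    · simp
    · rintro ⟨a, b⟩ -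
      simp only [bicoeff]
      congr 2 <;> congr 1 <;> ext k <;> fin_cases k <;> simp
  simpa only [Finset.Nat.sum_antidiagonal_eq_sum_range_succ_mk] using hsum

theorem bicoeff_of_lt_order [Semiring K] {i j : ℕ} {p : MvPowerSeries (Fin 2) K}
    (h : ((i + j : ℕ) : ℕ∞) < p.order) : bicoeff i j p = 0 :=
  MvPowerSeries.coeff_of_lt_order (by simpa using h)

end Bicoeff

section LocalIntersections

variable {K : Type*} [Field K] {ξ a b : MvPowerSeries (Fin 2) K}

section Coefficients

variable (hξ : bicoeff 0 0 ξ = 0) (hb : ∀ i j, i + j < 3 → bicoeff i j b = 0)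

include hξ hb

theorem bicoeff_two_zero_mul_add :
    bicoeff 2 0 (ξ * (ξ * a + b)) = bicoeff 1 0 ξ ^ 2 * bicoeff 0 0 a := by
  simp only [bicoeff_mul, bicoeff_add, Finset.sum_range_succ, Finset.sum_range_zero, Nat.reduceAdd,
    Nat.reduceSub, Nat.reduceLT, hξ, hb]
  ring

theorem bicoeff_one_one_mul_add :
    bicoeff 1 1 (ξ * (ξ * a + b)) = 2 * bicoeff 1 0 ξ * bicoeff 0 1 ξ * bicoeff 0 0 a := by
  simp only [bicoeff_mul, bicoeff_add, Finset.sum_range_succ, Finset.sum_range_zero, Nat.reduceAdd,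
    Nat.reduceSub, Nat.reduceLT, hξ, hb]
  ring

theorem bicoeff_zero_two_mul_add :
    bicoeff 0 2 (ξ * (ξ * a + b)) = bicoeff 0 1 ξ ^ 2 * bicoeff 0 0 a := by
  simp only [bicoeff_mul, bicoeff_add, Finset.sum_range_succ, Finset.sum_range_zero, Nat.reduceAdd,
    Nat.reduceSub, Nat.reduceLT, hξ, hb]
  ring

theorem bicoeff_three_zero_mul_add :
    bicoeff 3 0 (ξ * (ξ * a + b)) =
      bicoeff 1 0 ξ ^ 2 * bicoeff 1 0 a + 2 * bicoeff 1 0 ξ * bicoeff 2 0 ξ * bicoeff 0 0 a := by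
  simp only [bicoeff_mul, bicoeff_add, Finset.sum_range_succ, Finset.sum_range_zero, Nat.reduceAdd,
    Nat.reduceSub, Nat.reduceLT, hξ, hb]
  ring

theorem bicoeff_two_one_mul_add :
    bicoeff 2 1 (ξ * (ξ * a + b)) =
      bicoeff 1 0 ξ ^ 2 * bicoeff 0 1 a + 2 * bicoeff 1 0 ξ * bicoeff 0 1 ξ * bicoeff 1 0 a +
        2 * (bicoeff 1 0 ξ * bicoeff 1 1 ξ + bicoeff 0 1 ξ * bicoeff 2 0 ξ) * bicoeff 0 0 a := by
  simp only [bicoeff_mul, bicoeff_add, Finset.sum_range_succ, Finset.sum_range_zero, Nat.reduceAdd,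
    Nat.reduceSub, Nat.reduceLT, hξ, hb]
  ring

theorem bicoeff_one_two_mul_add :
    bicoeff 1 2 (ξ * (ξ * a + b)) =
      bicoeff 0 1 ξ ^ 2 * bicoeff 1 0 a + 2 * bicoeff 1 0 ξ * bicoeff 0 1 ξ * bicoeff 0 1 a +
        2 * (bicoeff 0 1 ξ * bicoeff 1 1 ξ + bicoeff 1 0 ξ * bicoeff 0 2 ξ) * bicoeff 0 0 a := by
  simp only [bicoeff_mul, bicoeff_add, Finset.sum_range_succ, Finset.sum_range_zero, Nat.reduceAdd,
    Nat.reduceSub, Nat.reduceLT, hξ, hb]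
  ring

theorem bicoeff_zero_three_mul_add :
    bicoeff 0 3 (ξ * (ξ * a + b)) =
      bicoeff 0 1 ξ ^ 2 * bicoeff 0 1 a + 2 * bicoeff 0 1 ξ * bicoeff 0 2 ξ * bicoeff 0 0 a := by
  simp only [bicoeff_mul, bicoeff_add, Finset.sum_range_succ, Finset.sum_range_zero, Nat.reduceAdd,
    Nat.reduceSub, Nat.reduceLT, hξ, hb]
  ring

theorem bicoeff_four_zero_mul_add (h : bicoeff 1 0 ξ = 0) :
    bicoeff 4 0 (ξ * (ξ * a + b)) = bicoeff 2 0 ξ ^ 2 * bicoeff 0 0 a := by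
  simp only [bicoeff_mul, bicoeff_add, Finset.sum_range_succ, Finset.sum_range_zero, Nat.reduceAdd,
    Nat.reduceSub, Nat.reduceLT, hξ, hb, h]
  ring

theorem mul_add_ne_node : ξ * (ξ * a + b) ≠ MvPowerSeries.X 0 * MvPowerSeries.X 1 := by
  intro heq
  have h20 : bicoeff 1 0 ξ ^ 2 * bicoeff 0 0 a = 0 := by
    rw [← bicoeff_two_zero_mul_add hξ hb, heq]
    simp [bicoeff_mul, bicoeff_X_zero, bicoeff_X_one]
  have h11 : 2 * bicoeff 1 0 ξ * bicoeff 0 1 ξ * bicoeff 0 0 a = 1 := by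
    rw [← bicoeff_one_one_mul_add hξ hb, heq]
    simp [bicoeff_mul, bicoeff_X_zero, bicoeff_X_one, Finset.sum_range_succ]
  rcases mul_eq_zero.mp h20 with h | h
  · simp [pow_eq_zero_iff two_ne_zero |>.mp h] at h11
  · simp [h] at h11

theorem mul_add_ne_tacnode :
    ξ * (ξ * a + b) ≠ MvPowerSeries.X 1 * (MvPowerSeries.X 1 - MvPowerSeries.X 0 ^ 2) := by
  rw [sq (MvPowerSeries.X 0 : MvPowerSeries (Fin 2) K)]
  intro heq
  have h20 : bicoeff 1 0 ξ ^ 2 * bicoeff 0 0 a = 0 := by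
    rw [← bicoeff_two_zero_mul_add hξ hb, heq]
    simp [bicoeff_mul, bicoeff_sub, bicoeff_X_zero, bicoeff_X_one, Finset.sum_range_succ]
  have h02 : bicoeff 0 1 ξ ^ 2 * bicoeff 0 0 a = 1 := by
    rw [← bicoeff_zero_two_mul_add hξ hb, heq]
    simp [bicoeff_mul, bicoeff_sub, bicoeff_X_zero, bicoeff_X_one, Finset.sum_range_succ]
  have ha : bicoeff 0 0 a ≠ 0 := right_ne_zero_of_mul_eq_one h02
  have h10 : bicoeff 1 0 ξ = 0 := by simpa [ha] using h20
  have h40 : bicoeff 2 0 ξ ^ 2 * bicoeff 0 0 a = 0 := by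
    rw [← bicoeff_four_zero_mul_add hξ hb h10, heq]
    simp [bicoeff_mul, bicoeff_sub, bicoeff_X_zero, bicoeff_X_one, Finset.sum_range_succ]
  have hξ20 : bicoeff 2 0 ξ = 0 := by simpa [ha] using h40
  have h21 := bicoeff_two_one_mul_add (a := a) hξ hb
  simp [heq, h10, hξ20, bicoeff_mul, bicoeff_sub, bicoeff_X_zero, bicoeff_X_one,
    Finset.sum_range_succ] at h21

theorem mul_add_ne_triplePoint :
    ξ * (ξ * a + b) ≠
      MvPowerSeries.X 0 * MvPowerSeries.X 1 * (MvPowerSeries.X 0 + MvPowerSeries.X 1) := by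
  intro heq
  have h21 := bicoeff_two_one_mul_add (a := a) hξ hb
  rw [heq, show bicoeff 2 1 _ = (1 : K) by
    simp [bicoeff_mul, bicoeff_add, bicoeff_X_zero, bicoeff_X_one, Finset.sum_range_succ]] at h21
  have h12 := bicoeff_one_two_mul_add (a := a) hξ hb
  rw [heq, show bicoeff 1 2 _ = (1 : K) by
    simp [bicoeff_mul, bicoeff_add, bicoeff_X_zero, bicoeff_X_one, Finset.sum_range_succ]] at h12
  rcases eq_or_ne (bicoeff 0 0 a) 0 with ha | ha
  · have h10 : bicoeff 1 0 ξ ≠ 0 := fun h => by simp [h, ha] at h21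
    have h01 : bicoeff 0 1 ξ ≠ 0 := fun h => by simp [h, ha] at h12
    have ha10 : bicoeff 1 0 a = 0 := by
      have h30 := bicoeff_three_zero_mul_add (a := a) hξ hb
      simpa [heq, bicoeff_mul, bicoeff_add, bicoeff_X_zero, bicoeff_X_one, Finset.sum_range_succ,
        ha, h10] using h30
    have ha01 : bicoeff 0 1 a = 0 := by
      have h03 := bicoeff_zero_three_mul_add (a := a) hξ hb
      simpa [heq, bicoeff_mul, bicoeff_add, bicoeff_X_zero, bicoeff_X_one, Finset.sum_range_succ,
        ha, h01] using h03
    simp [ha, ha10, ha01] at h21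
  · have h10 : bicoeff 1 0 ξ = 0 := by
      have h20 := bicoeff_two_zero_mul_add (a := a) hξ hb
      simpa [heq, bicoeff_mul, bicoeff_add, bicoeff_X_zero, bicoeff_X_one, Finset.sum_range_succ,
        ha] using h20
    have h01 : bicoeff 0 1 ξ = 0 := by
      have h02 := bicoeff_zero_two_mul_add (a := a) hξ hb
      simpa [heq, bicoeff_mul, bicoeff_add, bicoeff_X_zero, bicoeff_X_one, Finset.sum_range_succ,
        ha] using h02
    simp [h10, h01] at h21

end Coefficients

end LocalIntersections

section LocalEquation

variable {P g u v h : S} {p : Fin 3 → ℂ} {N : ℕ} {G : R}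

theorem constantCoeff_localEquation (f : S) (v w₁ w₂ : Fin 3 → ℂ) :
    MvPowerSeries.constantCoeff (localEquation f v w₁ w₂) = eval v f := by
  rw [localEquation, map_aeval, eval]
  refine congrArg (fun F : S →+* ℂ => F f) (MvPolynomial.ringHom_ext (fun r => ?_) fun i => ?_) <;>
    simp [MvPowerSeries.algebraMap_apply]

theorem constantCoeff_algEquiv_eq_zero {K σ : Type*} [Field K]
    (ψ : MvPowerSeries σ K ≃ₐ[K] MvPowerSeries σ K) {p : MvPowerSeries σ K}
    (hp : MvPowerSeries.constantCoeff p = 0) : MvPowerSeries.constantCoeff (ψ p) = 0 := by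
  by_contra h
  have hunit := (MvPowerSeries.isUnit_iff_constantCoeff.mpr (isUnit_iff_ne_zero.mpr h)).map ψ.symm
  rw [ψ.symm_apply_apply, MvPowerSeries.isUnit_iff_constantCoeff, hp] at hunit
  exact not_isUnit_zero hunit

/-- A branch meeting the rest of a curve with multiplicity at least three gives the curve a local
equation `ξ (ξ a + b)` with `b` of order at least three. -/
theorem not_hasLocalType_mul
    (hG : ∀ ξ a b : R, bicoeff 0 0 ξ = 0 → (∀ i j, i + j < 3 → bicoeff i j b = 0) →
      ξ * (ξ * a + b) ≠ G)
    (hP : eval p P = 0) (hu : eval p u ≠ 0) (hv : eval p v = 0)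
    (hg : P ∣ u ^ N * g - v ^ 3 * h) : ¬ HasLocalType (P * g) p G := by
  rintro ⟨w₁, w₂, -, ψ, c, hc⟩
  obtain ⟨q, hq⟩ := hg
  let Λ : S →ₐ[ℂ] R := aeval fun i => MvPowerSeries.C (p i) +
    MvPowerSeries.C (w₁ i) * MvPowerSeries.X 0 + MvPowerSeries.C (w₂ i) * MvPowerSeries.X 1
  have hΛ (F : S) : MvPowerSeries.constantCoeff (Λ F) = eval p F :=
    constantCoeff_localEquation F p w₁ w₂
  obtain ⟨U, hU⟩ : ∃ U, Λ (u ^ N) * U = 1 := IsUnit.exists_right_inv <| by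
    rw [MvPowerSeries.isUnit_iff_constantCoeff, hΛ, map_pow]
    exact (pow_ne_zero N hu).isUnit
  have hrel : Λ (u ^ N) * Λ g = Λ P * Λ q + Λ v ^ 3 * Λ h := by
    rw [← map_pow, ← map_mul, ← map_mul, ← map_mul, ← map_add]
    exact congrArg Λ (by linear_combination hq)
  have hΛg : Λ g = Λ P * (Λ q * U) + Λ v ^ 3 * (Λ h * U) := by
    linear_combination (-Λ g) * hU + U * hrel
  have hb : 3 ≤ (ψ (Λ v ^ 3 * (Λ h * U)) * c : R).order := by
    have hv3 := MvPowerSeries.le_order_pow_of_constantCoeff_eq_zero 3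
      (constantCoeff_algEquiv_eq_zero ψ ((hΛ v).trans hv))
    rw [map_mul, map_pow, mul_assoc]
    exact (hv3.trans le_self_add).trans MvPowerSeries.le_order_mul
  refine hG (ψ (Λ P)) (ψ (Λ q * U) * c) _ ?_
    (fun i j hij => bicoeff_of_lt_order (lt_of_lt_of_le (by exact_mod_cast hij) hb)) ?_
  · rw [bicoeff_zero_zero]
    exact constantCoeff_algEquiv_eq_zero ψ ((hΛ P).trans hP)
  · rw [← hc, localEquation]
    change _ = ψ (Λ (P * g)) * c
    rw [map_mul Λ, hΛg]
    simp only [map_mul, map_add]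
    ring

theorem rootMultiplicity_le_two {e d : ℕ} (φ : RationalParam P e)
    (hf : OnlyNodesTacnodesTriplePoints (P * g)) (hg : g.IsHomogeneous d)
    (hg0 : aeval φ.coord g ≠ 0) (t : ℂ) : (aeval φ.coord g).rootMultiplicity t ≤ 2 := by
  by_contra! h3
  have hdvd : (Polynomial.X - Polynomial.C t) ^ 3 ∣ aeval φ.coord g :=
    (Polynomial.le_rootMultiplicity_iff hg0).mp h3
  obtain ⟨N, h, hN⟩ := φ.exists_dvd_den_pow_mul_sub hg hdvd
  have hPp := φ.eval_point_self t
  have hgp : eval (φ.point t) g = 0 := by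
    rw [φ.eval_point]
    exact Polynomial.dvd_iff_isRoot.mp ((dvd_pow_self _ three_ne_zero).trans hdvd)
  have hsing : IsSingularAt (P * g) (φ.point t) := by
    refine ⟨by rw [map_mul, hPp, zero_mul], fun i => ?_⟩
    simp [Derivation.leibniz, hPp, hgp]
  have hden : eval (φ.point t) φ.den ≠ 0 := by simp [φ.eval_point_den]
  have hnum : eval (φ.point t) (φ.num - t • φ.den) = 0 := by
    simp [φ.eval_point_num, φ.eval_point_den, smul_eval]
  have hlocal (G : R) (hG : ∀ ξ a b : R, bicoeff 0 0 ξ = 0 →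
      (∀ i j, i + j < 3 → bicoeff i j b = 0) → ξ * (ξ * a + b) ≠ G) :
      ¬ HasLocalType (P * g) (φ.point t) G := not_hasLocalType_mul hG hPp hden hnum hN
  rcases hf _ (φ.point_ne_zero t) hsing with hnode | htacnode | htriple
  · exact hlocal _ (fun _ _ _ => mul_add_ne_node) hnode
  · exact hlocal _ (fun _ _ _ => mul_add_ne_tacnode) htacnode
  · exact hlocal _ (fun _ _ _ => mul_add_ne_triplePoint) htriple

end LocalEquation

/-! ### One-forms leaving curves invariant -/

section LinearAlgebra

variable {K V W : Type*} [Field K] [AddCommGroup V] [Module K V] [AddCommGroup W] [Module K W]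

theorem finrank_map_add_finrank_inf_ker (D : Submodule K V) [FiniteDimensional K D]
    (T : V →ₗ[K] W) :
    Module.finrank K (D.map T) + Module.finrank K ↥(D ⊓ LinearMap.ker T) = Module.finrank K D := by
  rw [← (T.domRestrict D).finrank_range_add_finrank_ker, LinearMap.range_domRestrict,
    LinearMap.ker_domRestrict, (Submodule.equivSubtypeMap D _).finrank_eq,
    Submodule.map_comap_subtype]

theorem finrank_le_finrank_add_finrank_of_le {D B : Submodule K V} [FiniteDimensional K D]
    [FiniteDimensional K B] (T : V →ₗ[K] W) {A : Submodule K W} [FiniteDimensional K A]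
    (hA : D ≤ A.comap T) (hB : D ⊓ LinearMap.ker T ≤ B) :
    Module.finrank K D ≤ Module.finrank K A + Module.finrank K B := by
  rw [← finrank_map_add_finrank_inf_ker D T]
  exact add_le_add (Submodule.finrank_mono (Submodule.map_le_iff_le_comap.mpr hA))
    (Submodule.finrank_mono hB)

theorem finrank_degreeLT (n : ℕ) : Module.finrank K (Polynomial.degreeLT K n) = n := by
  simp [Module.finrank_eq_card_basis (Polynomial.degreeLT.basis K n)]

end LinearAlgebra

section Forms

variable {κ σ ι K : Type*} [Field K]

variable (κ σ K) in
/-- The tuples of homogeneous polynomials of degree `s`, seen as coefficients of differential forms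
or of vector fields. -/
def homogeneousTuples (s : ℕ) : Submodule K (κ → MvPolynomial σ K) :=
  Submodule.pi Set.univ fun _ => homogeneousSubmodule σ K s

theorem mem_homogeneousTuples {s : ℕ} {ω : κ → MvPolynomial σ K} :
    ω ∈ homogeneousTuples κ σ K s ↔ ∀ a, (ω a).IsHomogeneous s := by
  simp [homogeneousTuples, Submodule.mem_pi, mem_homogeneousSubmodule]

instance [Finite κ] [Finite σ] (s : ℕ) : FiniteDimensional K (homogeneousTuples κ σ K s) :=
  Module.Finite.iff_fg.mpr (Submodule.fg_pi fun _ => homogeneousSubmodule_fg σ K s)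

variable [Fintype σ]

/-- The forms `∑ a, ω a dxₐ` with homogeneous coefficients of degree `s` that vanish on the Euler
field and leave the hypersurfaces `Z j = 0`, `j ∈ Y`, invariant: `Z j` divides `d(Z j) ∧ ω`. -/
def logForms (Z : ι → MvPolynomial σ K) (Y : Finset ι) (s : ℕ) :
    Submodule K (σ → MvPolynomial σ K) where
  carrier := {ω | (∀ a, (ω a).IsHomogeneous s) ∧ ∑ a, X a * ω a = 0 ∧
    ∀ j ∈ Y, ∀ a b, Z j ∣ pderiv a (Z j) * ω b - pderiv b (Z j) * ω a}
  zero_mem' := ⟨fun _ => isHomogeneous_zero _ _ _, by simp, by simp⟩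
  add_mem' := by
    rintro ω η ⟨hω, hωX, hωZ⟩ ⟨hη, hηX, hηZ⟩
    refine ⟨fun a => (hω a).add (hη a), ?_, fun j hj a b => ?_⟩
    · simp [mul_add, Finset.sum_add_distrib, hωX, hηX]
    · convert dvd_add (hωZ j hj a b) (hηZ j hj a b) using 1
      simp only [Pi.add_apply]
      ring
  smul_mem' := by
    rintro c ω ⟨hω, hωX, hωZ⟩
    refine ⟨fun a => (homogeneousSubmodule σ K s).smul_mem c (hω a), ?_, fun j hj a b => ?_⟩
    · simp [← Finset.smul_sum, hωX]
    · convert (hωZ j hj a b).mul_left (C c) using 1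
      simp only [Pi.smul_apply, smul_eq_C_mul]
      ring

instance (Z : ι → MvPolynomial σ K) (Y : Finset ι) (s : ℕ) :
    FiniteDimensional K (logForms Z Y s) :=
  Submodule.finiteDimensional_of_le fun _ hω => mem_homogeneousTuples.mpr hω.1

theorem logForms_zero (Z : ι → MvPolynomial σ K) (Y : Finset ι) : logForms Z Y 0 = ⊥ := by
  rw [eq_bot_iff]
  rintro ω ⟨hω, hωX, -⟩
  have hC (a : σ) : ω a = C (coeff 0 (ω a)) := by
    rw [← homogeneousComponent_zero, homogeneousComponent_eq_self (hω a)]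
  have hlin : linForm (fun a => coeff 0 (ω a)) = 0 := by
    rw [← hωX, linForm_apply]
    exact Finset.sum_congr rfl fun a _ => by rw [← hC a, mul_comm]
  have hcoeff := linForm_injective (hlin.trans (map_zero _).symm)
  ext1 a
  rw [hC a, congrFun hcoeff a, Pi.zero_apply, C_0, Pi.zero_apply]

end Forms

section Restriction

variable {σ K : Type*} [Field K]

theorem exists_sum_mul_eq_one [IsAlgClosed K] [Fintype σ] {n : σ → K[X]}
    (h : ∀ t, ∃ a, (n a).eval t ≠ 0) : ∃ c : σ → K[X], ∑ a, c a * n a = 1 := by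
  obtain ⟨g, hg⟩ := (IsPrincipalIdealRing.principal (Ideal.span (Set.range n))).principal
  have hdvd (a : σ) : g ∣ n a := by
    rw [← Ideal.mem_span_singleton, Ideal.span, ← hg]
    exact Ideal.subset_span (Set.mem_range_self a)
  have hunit : IsUnit g := by
    rw [Polynomial.isUnit_iff_degree_eq_zero]
    by_contra hdeg
    obtain ⟨t, ht⟩ := IsAlgClosed.exists_root g hdeg
    obtain ⟨a, ha⟩ := h t
    exact ha (Polynomial.IsRoot.dvd ht (hdvd a))
  have hone : (1 : K[X]) ∈ Ideal.span (Set.range n) := by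
    rw [hg, ← Ideal.span, Ideal.mem_span_singleton]
    exact hunit.dvd
  simpa [Ideal.span, Submodule.mem_span_range_iff_exists_fun] using hone

theorem eval_eq_zero_of_dvd_mul_derivative [CharZero K] {F w : K[X]} (hF : F ≠ 0)
    (h : F ∣ w * Polynomial.derivative F) {t : K} (ht : F.IsRoot t) : w.eval t = 0 := by
  by_contra hw
  have hw0 : w ≠ 0 := by
    rintro rfl
    exact hw Polynomial.eval_zero
  have hpos := (Polynomial.rootMultiplicity_pos hF).mpr ht
  have hd : Polynomial.derivative F ≠ 0 := by
    intro hd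
    obtain ⟨c, rfl⟩ := Polynomial.natDegree_eq_zero.mp (Polynomial.derivative_eq_zero.mp hd)
    rw [Polynomial.IsRoot, Polynomial.eval_C] at ht
    exact hF (by rw [ht, Polynomial.C_0])
  have hle := Polynomial.rootMultiplicity_le_rootMultiplicity_of_dvd (mul_ne_zero hw0 hd) h t
  rw [Polynomial.rootMultiplicity_mul (mul_ne_zero hw0 hd),
    Polynomial.rootMultiplicity_eq_zero hw, Polynomial.derivative_rootMultiplicity_of_root ht]
    at hle
  omega

theorem mem_map_mulLeft_degreeLT {w : K[X]} {M : ℕ} {p : Finset K}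
    (hdeg : w ≠ 0 → w.natDegree < M) (hroot : ∀ t ∈ p, w.eval t = 0) :
    w ∈ (Polynomial.degreeLT K (M - p.card)).map
      (LinearMap.mulLeft K (∏ t ∈ p, (Polynomial.X - Polynomial.C t))) := by
  have hmonic := Polynomial.monic_prod_of_monic p (fun t => Polynomial.X - Polynomial.C t)
    fun t _ => Polynomial.monic_X_sub_C t
  obtain ⟨q, hq⟩ : ∏ t ∈ p, (Polynomial.X - Polynomial.C t) ∣ w := Finset.prod_dvd_of_coprime
    (fun a _ b _ hab => Polynomial.pairwise_coprime_X_sub_C Function.injective_id hab)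
    fun t ht => Polynomial.dvd_iff_isRoot.mpr (hroot t ht)
  refine ⟨q, ?_, hq.symm⟩
  rw [SetLike.mem_coe, Polynomial.mem_degreeLT]
  rcases eq_or_ne q 0 with rfl | hq0
  · rw [Polynomial.degree_zero]
    exact WithBot.bot_lt_coe _
  · have hlt := hdeg (by rw [hq]; exact mul_ne_zero hmonic.ne_zero hq0)
    rw [hq, Polynomial.natDegree_mul hmonic.ne_zero hq0,
      Polynomial.natDegree_finsetProd_X_sub_C_eq_card] at hlt
    rw [← Polynomial.natDegree_lt_iff_degree_lt hq0]
    omega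

end Restriction

namespace RationalParam

variable {σ K : Type*} [Field K] {P Q : MvPolynomial σ K} {e s : ℕ} (φ : RationalParam P e)

theorem exists_sum_mul_aeval_pderiv_eq_one [IsAlgClosed K] [Fintype σ]
    (hsmooth : ∀ v, (∀ a, eval v (pderiv a P) = 0) → v = 0) :
    ∃ c : σ → K[X], ∑ a, c a * aeval φ.coord (pderiv a P) = 1 :=
  exists_sum_mul_eq_one fun t => by
    by_contra! h
    exact φ.point_ne_zero t (hsmooth _ fun a => by rw [φ.eval_point, h a])

theorem exists_aeval_coord_eq_mul [IsAlgClosed K] [Finite σ]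
    (hsmooth : ∀ v, (∀ a, eval v (pderiv a P) = 0) → v = 0) :
    ∃ T : (σ → MvPolynomial σ K) →ₗ[K] K[X], ∀ ω,
      (∀ a b, P ∣ pderiv a P * ω b - pderiv b P * ω a) →
        ∀ b, aeval φ.coord (ω b) = T ω * aeval φ.coord (pderiv b P) := by
  cases nonempty_fintype σ
  obtain ⟨c, hc⟩ := φ.exists_sum_mul_aeval_pderiv_eq_one hsmooth
  refine ⟨∑ a, LinearMap.mulLeft K (c a) ∘ₗ (aeval φ.coord).toLinearMap ∘ₗ LinearMap.proj a,
    fun ω hω b => ?_⟩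
  have hcomm (a : σ) : aeval φ.coord (pderiv a P) * aeval φ.coord (ω b) =
      aeval φ.coord (pderiv b P) * aeval φ.coord (ω a) := by
    have h0 := map_dvd (aeval φ.coord) (hω a b)
    rwa [φ.aeval_coord_self, zero_dvd_iff, map_sub, map_mul, map_mul, sub_eq_zero] at h0
  calc aeval φ.coord (ω b)
      = ∑ a, c a * (aeval φ.coord (pderiv a P) * aeval φ.coord (ω b)) := by
        simp only [← mul_assoc, ← Finset.sum_mul, hc, one_mul]
    _ = ∑ a, c a * aeval φ.coord (ω a) * aeval φ.coord (pderiv b P) :=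
        Finset.sum_congr rfl fun a _ => by rw [hcomm a]; ring
    _ = _ := by simp [LinearMap.sum_apply, Finset.sum_mul]

theorem natDegree_lt_of_aeval_coord_eq_mul (hP : P.IsHomogeneous e)
    (hsmooth : ∀ v, (∀ a, eval v (pderiv a P) = 0) → v = 0) {ω : σ → MvPolynomial σ K}
    (hω : ∀ b, (ω b).IsHomogeneous s) {w : K[X]} (hw0 : w ≠ 0)
    (hw : ∀ b, aeval φ.coord (ω b) = w * aeval φ.coord (pderiv b P)) :
    w.natDegree < e * s + 1 - e * (e - 1) := by
  obtain ⟨b, hb⟩ : ∃ b, eval φ.infinity (pderiv b P) ≠ 0 := by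
    by_contra! h
    exact φ.coeff_ne_zero (hsmooth _ h)
  rw [φ.eval_infinity hP.pderiv] at hb
  have hwdeg := natDegree_aeval_le φ.natDegree_coord_le (hω b)
  have hb0 : aeval φ.coord (pderiv b P) ≠ 0 := fun h0 => hb (by rw [h0, Polynomial.coeff_zero])
  rw [hw b, Polynomial.natDegree_mul hw0 hb0] at hwdeg
  have := Polynomial.le_natDegree_of_ne_zero hb
  omega

/-- Along the curve `ω = w dP`, and `dP` annihilates the tangent vector; contracting `dQ ∧ ω` with
it therefore leaves `w` times the derivative of `Q` times `dP`. -/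
theorem aeval_coord_dvd_mul_derivative [IsAlgClosed K] [Finite σ]
    (hsmooth : ∀ v, (∀ a, eval v (pderiv a P) = 0) → v = 0) {ω : σ → MvPolynomial σ K} {w : K[X]}
    (hw : ∀ b, aeval φ.coord (ω b) = w * aeval φ.coord (pderiv b P))
    (hQ : ∀ a b, Q ∣ pderiv a Q * ω b - pderiv b Q * ω a) :
    aeval φ.coord Q ∣ w * Polynomial.derivative (aeval φ.coord Q) := by
  cases nonempty_fintype σ
  obtain ⟨c, hc⟩ := φ.exists_sum_mul_aeval_pderiv_eq_one hsmooth
  set n : σ → K[X] := fun a => aeval φ.coord (pderiv a P)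
  set g : σ → K[X] := fun a => aeval φ.coord (pderiv a Q)
  set τ : σ → K[X] := fun a => Polynomial.derivative (φ.coord a)
  have hP : ∑ a, n a * τ a = 0 := by
    rw [← derivative_aeval, φ.aeval_coord_self, Polynomial.derivative_zero]
  have hdvd (a b : σ) : aeval φ.coord Q ∣ w * (g a * n b - g b * n a) := by
    convert map_dvd (aeval φ.coord) (hQ a b) using 1
    rw [map_sub, map_mul, map_mul, hw, hw]
    ring
  have hcontract (b : σ) : w * (∑ a, g a * τ a) * n b =
      ∑ a, w * (g a * n b - g b * n a) * τ a := by
    calc w * (∑ a, g a * τ a) * n b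
        = w * (n b * ∑ a, g a * τ a - g b * ∑ a, n a * τ a) := by rw [hP]; ring
      _ = ∑ a, w * (g a * n b - g b * n a) * τ a := by
          simp only [Finset.mul_sum, ← Finset.sum_sub_distrib]
          exact Finset.sum_congr rfl fun a _ => by ring
  rw [derivative_aeval, ← mul_one (w * _), ← hc, Finset.mul_sum]
  refine Finset.dvd_sum fun b _ => ?_
  rw [mul_left_comm, hcontract b]
  exact (Finset.dvd_sum fun a _ => (hdvd a b).mul_right _).mul_left _

end RationalParam

/-- Plane-curve-like data to which the restriction argument applies: smooth rationally parametrized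
hypersurfaces `Z i = 0` of degrees `e i`, none containing another, such that no parametrization
meets another curve at infinity and the curve `i` meets the union of the others with multiplicity at
most two at every point. -/
structure CurveSystem {ι σ K : Type*} [Field K] (Z : ι → MvPolynomial σ K) (e : ι → ℕ) where
  param : ∀ i, RationalParam (Z i) (e i)
  isHomogeneous : ∀ i, (Z i).IsHomogeneous (e i)
  ne_zero : ∀ i, Z i ≠ 0
  not_dvd : ∀ i j, i ≠ j → ¬ Z i ∣ Z j
  eq_zero_of_pderiv : ∀ i v, (∀ a, eval v (pderiv a (Z i)) = 0) → v = 0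
  eval_infinity_ne_zero : ∀ i j, i ≠ j → eval (param i).infinity (Z j) ≠ 0
  rootMultiplicity_le_two : ∀ (i : ι) (Y : Finset ι), i ∉ Y → ∀ t : K,
    (∏ j ∈ Y, aeval (param i).coord (Z j)).rootMultiplicity t ≤ 2

namespace CurveSystem

variable {ι σ K : Type*} [Field K] {Z : ι → MvPolynomial σ K} {e : ι → ℕ} (H : CurveSystem Z e)

/-- The polynomial in the parameter of the `i`-th curve that cuts out its points on the curves
`Z j = 0`, `j ∈ Y`, with multiplicity. -/
def trace (i : ι) (Y : Finset ι) : K[X] := ∏ j ∈ Y, aeval (H.param i).coord (Z j)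

open scoped Classical in
/-- The parameters of the points of the `i`-th curve on the curves `Z j = 0`, `j ∈ Y`. -/
def points (i : ι) (Y : Finset ι) : Finset K := (H.trace i Y).roots.toFinset

include H in
theorem prime (i : ι) : Prime (Z i) := (H.param i).prime (H.isHomogeneous i) (H.ne_zero i)

theorem aeval_ne_zero {i j : ι} (hij : i ≠ j) : aeval (H.param i).coord (Z j) ≠ 0 := fun h =>
  H.not_dvd i j hij ((H.param i).dvd_of_aeval_coord_eq_zero (H.isHomogeneous j) h)

theorem trace_ne_zero {i : ι} {Y : Finset ι} (hi : i ∉ Y) : H.trace i Y ≠ 0 :=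
  Finset.prod_ne_zero_iff.mpr fun _ hj => H.aeval_ne_zero (ne_of_mem_of_not_mem hj hi).symm

theorem natDegree_trace {i : ι} {Y : Finset ι} (hi : i ∉ Y) :
    (H.trace i Y).natDegree = e i * ∑ j ∈ Y, e j := by
  have hne {j : ι} (hj : j ∈ Y) : i ≠ j := (ne_of_mem_of_not_mem hj hi).symm
  rw [trace, Polynomial.natDegree_prod _ _ fun j hj => H.aeval_ne_zero (hne hj), Finset.mul_sum]
  refine Finset.sum_congr rfl fun j hj => le_antisymm
    (natDegree_aeval_le (H.param i).natDegree_coord_le (H.isHomogeneous j))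
    (Polynomial.le_natDegree_of_ne_zero ?_)
  rw [← (H.param i).eval_infinity (H.isHomogeneous j)]
  exact H.eval_infinity_ne_zero i j (hne hj)

theorem mem_points {i : ι} {Y : Finset ι} (hi : i ∉ Y) {t : K} :
    t ∈ H.points i Y ↔ ∃ j ∈ Y, eval ((H.param i).point t) (Z j) = 0 := by
  classical
  rw [points, Multiset.mem_toFinset, Polynomial.mem_roots (H.trace_ne_zero hi), trace,
    Polynomial.IsRoot, Polynomial.eval_prod, Finset.prod_eq_zero_iff]
  simp only [RationalParam.eval_point]

variable [Fintype σ]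

include H in
theorem exists_mem_logForms_mul_eq {i : ι} {Y : Finset ι} (hi : i ∉ Y) {s : ℕ}
    {ω : σ → MvPolynomial σ K} (hω : ω ∈ logForms Z Y s) (hdvd : ∀ a, Z i ∣ ω a) :
    ∃ η ∈ logForms Z Y (s - e i), ω = fun a => Z i * η a := by
  obtain ⟨hωs, hωX, hωZ⟩ := hω
  choose η hη hmul using fun a =>
    exists_isHomogeneous_mul_eq_of_dvd (H.isHomogeneous i) (hωs a) (hdvd a)
  refine ⟨η, ⟨hη, ?_, fun j hj a b => ?_⟩, _root_.funext hmul⟩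
  · refine (mul_eq_zero.mp (?_ : Z i * ∑ a, X a * η a = 0)).resolve_left (H.ne_zero i)
    rw [← hωX, Finset.mul_sum]
    exact Finset.sum_congr rfl fun a _ => by rw [hmul a]; ring
  · refine ((H.prime j).dvd_or_dvd (?_ : Z j ∣ Z i * _)).resolve_left
      (H.not_dvd j i (ne_of_mem_of_not_mem hj hi))
    convert hωZ j hj a b using 1
    rw [hmul a, hmul b]
    ring

theorem finrank_logForms_insert_le [DecidableEq ι] [IsAlgClosed K] [CharZero K] {i : ι}
    {Y : Finset ι} (hi : i ∉ Y) (s : ℕ) : Module.finrank K (logForms Z (insert i Y) s) ≤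
      (e i * s + 1 - e i * (e i - 1) - (H.points i Y).card) +
        Module.finrank K (logForms Z Y (s - e i)) := by
  obtain ⟨T, hT⟩ := (H.param i).exists_aeval_coord_eq_mul (H.eq_zero_of_pderiv i)
  refine (finrank_le_finrank_add_finrank_of_le T
    (A := (Polynomial.degreeLT K _).map
      (LinearMap.mulLeft K (∏ t ∈ H.points i Y, (Polynomial.X - Polynomial.C t))))
    (B := (logForms Z Y (s - e i)).map (LinearMap.mulLeft K fun _ => Z i)) ?_ ?_).trans
    (add_le_add ((Submodule.finrank_map_le _ _).trans (finrank_degreeLT _).le)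
      (Submodule.finrank_map_le _ _))
  · intro ω hω
    have hTω := hT ω (hω.2.2 i (Finset.mem_insert_self i Y))
    refine mem_map_mulLeft_degreeLT (fun h0 => (H.param i).natDegree_lt_of_aeval_coord_eq_mul
      (H.isHomogeneous i) (H.eq_zero_of_pderiv i) hω.1 h0 hTω) fun t ht => ?_
    obtain ⟨j, hj, hjt⟩ := (H.mem_points hi).mp ht
    rw [RationalParam.eval_point] at hjt
    exact eval_eq_zero_of_dvd_mul_derivative
      (H.aeval_ne_zero (ne_of_mem_of_not_mem hj hi).symm)
      ((H.param i).aeval_coord_dvd_mul_derivative (H.eq_zero_of_pderiv i) hTω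
        (hω.2.2 j (Finset.mem_insert_of_mem hj))) hjt
  · rintro ω ⟨hω, hker⟩
    have hTω := hT ω (hω.2.2 i (Finset.mem_insert_self i Y))
    obtain ⟨η, hη, rfl⟩ := H.exists_mem_logForms_mul_eq hi (Y := Y) (s := s) (ω := ω)
      ⟨hω.1, hω.2.1, fun j hj => hω.2.2 j (Finset.mem_insert_of_mem hj)⟩ fun a =>
        (H.param i).dvd_of_aeval_coord_eq_zero (hω.1 a) (by
          rw [hTω a, LinearMap.mem_ker.mp hker, zero_mul])
    exact ⟨η, hη, rfl⟩

end CurveSystem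

/-! ### Syzygies of a free curve -/

theorem exists_linForm_mem_of_mul_mem {σ K : Type*} [Field K] [Infinite K] [Fintype σ] [Nonempty σ]
    {J : Ideal (MvPolynomial σ K)} (hJ : ∀ h, (∀ i, X i * h ∈ J) → h ∈ J) :
    ∃ a : σ → K, a ≠ 0 ∧ ∀ h, linForm a * h ∈ J → h ∈ J := by
  classical
  let formsIn (p : Ideal (MvPolynomial σ K)) : Submodule K (σ → K) :=
    (p.restrictScalars K).comap linForm
  have hfin := associatedPrimes.finite (MvPolynomial σ K) (MvPolynomial σ K ⧸ J)
  have htop : ⊤ ∉ insert ⊥ (hfin.toFinset.image formsIn) := by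
    rw [Finset.mem_insert, Finset.mem_image, not_or]
    refine ⟨top_ne_bot, fun ⟨p, hp, hptop⟩ => ?_⟩
    obtain ⟨hprime, x, hx⟩ := isAssociatedPrime_iff.mp (hfin.mem_toFinset.mp hp)
    obtain ⟨h, rfl⟩ := Ideal.Quotient.mk_surjective x
    have hX (i : σ) : X i * h ∈ J := by
      have hmem : Pi.single i 1 ∈ formsIn p := hptop ▸ Submodule.mem_top
      have hXp : X i ∈ p := by
        simpa [formsIn, linForm, Fintype.linearCombination_apply_single] using hmem
      rw [hx, Submodule.mem_colon_singleton, Submodule.mem_bot] at hXp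
      exact Ideal.Quotient.eq_zero_iff_mem.mp hXp
    apply hprime.ne_top
    rw [hx, Ideal.Quotient.eq_zero_iff_mem.mpr (hJ h hX), Ideal.eq_top_iff_one,
      Submodule.mem_colon_singleton, smul_zero]
    exact Submodule.zero_mem _
  obtain ⟨a, ha⟩ := (Set.ne_univ_iff_exists_notMem _).mp
    (Subspace.biUnion_ne_univ_of_top_notMem htop)
  simp only [Set.mem_iUnion, not_exists] at ha
  refine ⟨a, ha ⊥ (Finset.mem_insert_self _ _), fun h hmem => ?_⟩
  by_contra hh
  have hzero : linForm a ∈ {r | ∃ x : MvPolynomial σ K ⧸ J, x ≠ 0 ∧ r • x = 0} :=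
    ⟨Ideal.Quotient.mk J h, mt Ideal.Quotient.eq_zero_iff_mem.mp hh,
      Ideal.Quotient.eq_zero_iff_mem.mpr hmem⟩
  rw [← biUnion_associatedPrimes_eq_zero_divisors] at hzero
  obtain ⟨p, hp, hap⟩ := Set.mem_iUnion₂.mp hzero
  exact ha (formsIn p) (Finset.mem_insert_of_mem
    (Finset.mem_image_of_mem _ (hfin.mem_toFinset.mpr hp))) hap

theorem IsFree.mem_of_X_mul_mem {f h : S} (hf : IsFree f)
    (hh : ∀ i, X i * h ∈ jacobianIdeal f) : h ∈ jacobianIdeal f := by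
  refine Submodule.submoduleOf_eq_top.mp (Submodule.Quotient.subsingleton_iff.mp hf)
    (Submodule.mem_iSup_of_mem 1 ?_)
  rw [pow_one, Submodule.mem_colon]
  intro p hp
  have hle : irrelevantIdeal ≤ Submodule.colon (jacobianIdeal f) {h} := by
    rw [irrelevantIdeal, Ideal.span_le]
    rintro _ ⟨i, rfl⟩
    exact Submodule.mem_colon_singleton.mpr (hh i)
  simpa only [smul_eq_mul, mul_comm] using Submodule.mem_colon_singleton.mp (hle hp)

section PolyTuples

variable {κ K : Type*} [Field K]

theorem mem_degreeLT_succ {n : ℕ} {p : K[X]} :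
    p ∈ Polynomial.degreeLT K (n + 1) ↔ p.natDegree ≤ n := by
  rw [Polynomial.degreeLT_succ_eq_degreeLE, Polynomial.mem_degreeLE,
    Polynomial.natDegree_le_iff_degree_le]

variable (κ K) in
/-- The tuples of polynomials of degree at most `n`. -/
def polyTuples (n : ℕ) : Submodule K (κ → K[X]) :=
  LinearMap.range ((Polynomial.degreeLT K (n + 1)).subtype.compLeft κ)

theorem mem_polyTuples {n : ℕ} {q : κ → K[X]} :
    q ∈ polyTuples κ K n ↔ ∀ i, (q i).natDegree ≤ n := by
  simp [polyTuples, LinearMap.range_compLeft, Submodule.mem_pi, mem_degreeLT_succ]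

theorem finrank_polyTuples [Fintype κ] (n : ℕ) :
    Module.finrank K (polyTuples κ K n) = Fintype.card κ * (n + 1) := by
  rw [polyTuples, LinearMap.finrank_range_of_inj
    ((Polynomial.degreeLT K (n + 1)).injective_subtype.comp_left), Module.finrank_pi_fintype]
  simp [finrank_degreeLT]

instance [Finite κ] (n : ℕ) : FiniteDimensional K (polyTuples κ K n) := Module.Finite.range _

end PolyTuples

namespace RationalParam

variable {κ σ K : Type*} [Field K] {L : MvPolynomial σ K} {e : ℕ} (φ : RationalParam L e)

variable (κ) in
/-- The restriction of a tuple of polynomials to a parametrized hypersurface. -/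
def restrict : (κ → MvPolynomial σ K) →ₗ[K] (κ → K[X]) :=
  (aeval φ.coord).toLinearMap.compLeft κ

theorem restrict_apply (ρ : κ → MvPolynomial σ K) (i : κ) :
    φ.restrict κ ρ i = aeval φ.coord (ρ i) := rfl

end RationalParam

section Syzygies

variable {κ σ K : Type*} [Field K] [Fintype κ] {g : κ → MvPolynomial σ K} {m r : ℕ}

theorem exists_isHomogeneous_of_mem_span {h : MvPolynomial σ K} (hg : ∀ i, (g i).IsHomogeneous m)
    (hh : h.IsHomogeneous (m + r)) (hspan : h ∈ Ideal.span (Set.range g)) :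
    ∃ b : κ → MvPolynomial σ K, (∀ i, (b i).IsHomogeneous r) ∧ h = ∑ i, b i * g i := by
  rw [Ideal.span, Submodule.mem_span_range_iff_exists_fun] at hspan
  obtain ⟨c, rfl⟩ := hspan
  refine ⟨fun i => homogeneousComponent r (c i),
    fun i => homogeneousComponent_isHomogeneous _ _, ?_⟩
  conv_lhs => rw [← homogeneousComponent_eq_self hh, map_sum]
  refine Finset.sum_congr rfl fun i _ => ?_
  rw [smul_eq_mul, mul_comm, homogeneousComponent_mul_of_isHomogeneous (hg i), mul_comm]

/-- The linear relations of degree `r` between the polynomials `g i`. -/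
def syzygies (g : κ → MvPolynomial σ K) (r : ℕ) : Submodule K (κ → MvPolynomial σ K) :=
  homogeneousTuples κ σ K r ⊓
    ((Fintype.linearCombination (MvPolynomial σ K) g).restrictScalars K).ker

theorem mem_syzygies {ρ : κ → MvPolynomial σ K} :
    ρ ∈ syzygies g r ↔ (∀ i, (ρ i).IsHomogeneous r) ∧ ∑ i, ρ i * g i = 0 := by
  simp [syzygies, mem_homogeneousTuples, Fintype.linearCombination_apply]

instance [Finite σ] : FiniteDimensional K (syzygies g r) :=
  Submodule.finiteDimensional_of_le inf_le_left

namespace RationalParam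

variable {L : MvPolynomial σ K} (φ : RationalParam L 1)

theorem mem_map_restrict_syzygies (hL : L.IsHomogeneous 1)
    (hreg : ∀ h, L * h ∈ Ideal.span (Set.range g) → h ∈ Ideal.span (Set.range g))
    (hg : ∀ i, (g i).IsHomogeneous m) {q : κ → K[X]} (hq : q ∈ polyTuples κ K (r + 1))
    (hsum : ∑ i, q i * aeval φ.coord (g i) = 0) :
    q ∈ (syzygies g (r + 1)).map (φ.restrict κ) := by
  choose G hG hGq using fun i => φ.exists_isHomogeneous_aeval_coord_eq (d := r + 1)
    (mem_polyTuples.mp hq i)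
  have hGg : (∑ i, G i * g i).IsHomogeneous (r + 1 + m) :=
    IsHomogeneous.sum _ _ _ fun i _ => (hG i).mul (hg i)
  have hvan : aeval φ.coord (∑ i, G i * g i) = 0 := by
    simp only [map_sum, map_mul, hGq, hsum]
  obtain ⟨h, hh, hmul⟩ := exists_isHomogeneous_mul_eq_of_dvd hL hGg
    (φ.dvd_of_aeval_coord_eq_zero hGg hvan)
  have hspan : h ∈ Ideal.span (Set.range g) := hreg h (hmul ▸ Ideal.sum_mem _ fun i _ =>
    Ideal.mul_mem_left _ _ (Ideal.subset_span (Set.mem_range_self i)))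
  obtain ⟨c, hc, rfl⟩ := exists_isHomogeneous_of_mem_span (r := r) hg
    (by rwa [show r + 1 + m - 1 = m + r by omega] at hh) hspan
  refine ⟨fun i => G i - L * c i, mem_syzygies.mpr ⟨fun i => (hG i).sub ?_, ?_⟩, ?_⟩
  · exact add_comm 1 r ▸ hL.mul (hc i)
  · simp only [sub_mul, Finset.sum_sub_distrib, mul_assoc, ← Finset.mul_sum, hmul, sub_self]
  · ext1 i
    rw [restrict_apply, map_sub, map_mul, φ.aeval_coord_self, zero_mul, sub_zero, hGq]

theorem mul_mem_syzygies_inf_ker (hL : L.IsHomogeneous 1) {ρ : κ → MvPolynomial σ K}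
    (hρ : ρ ∈ syzygies g r) :
    (fun i => L * ρ i) ∈ syzygies g (r + 1) ⊓ LinearMap.ker (φ.restrict κ) := by
  obtain ⟨hρr, hρg⟩ := mem_syzygies.mp hρ
  refine ⟨mem_syzygies.mpr ⟨fun i => add_comm 1 r ▸ hL.mul (hρr i), ?_⟩, ?_⟩
  · simp only [mul_assoc, ← Finset.mul_sum, hρg, mul_zero]
  · ext1 i
    rw [restrict_apply, map_mul, φ.aeval_coord_self, zero_mul, Pi.zero_apply]

include φ in
/-- A regular linear form `L` gives an exact sequence `0 → syz r → syz (r + 1) → syz' (r + 1) → 0`,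
where `syz'` are the syzygies of the restrictions to `L = 0`. -/
theorem finrank_syzygies_succ [Finite σ] (hL : L.IsHomogeneous 1) (hL0 : L ≠ 0)
    (hreg : ∀ h, L * h ∈ Ideal.span (Set.range g) → h ∈ Ideal.span (Set.range g))
    (hg : ∀ i, (g i).IsHomogeneous m) :
    Fintype.card κ * (r + 2) + Module.finrank K (syzygies g r) ≤
      Module.finrank K (syzygies g (r + 1)) + (r + m + 2) := by
  let Ψ : (κ → K[X]) →ₗ[K] K[X] :=
    (Fintype.linearCombination K[X] fun i => aeval φ.coord (g i)).restrictScalars K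
  have hΨ (q : κ → K[X]) : Ψ q = ∑ i, q i * aeval φ.coord (g i) :=
    Fintype.linearCombination_apply _ _ _
  have hmap : (polyTuples κ K (r + 1)).map Ψ ≤ Polynomial.degreeLT K (r + m + 2) := by
    rintro _ ⟨q, hq, rfl⟩
    rw [hΨ, show r + m + 2 = r + 1 + m + 1 by ring, mem_degreeLT_succ]
    refine Polynomial.natDegree_sum_le_of_forall_le _ _ fun i _ => ?_
    refine Polynomial.natDegree_mul_le.trans (add_le_add (mem_polyTuples.mp hq i) ?_)
    simpa using natDegree_aeval_le φ.natDegree_coord_le (hg i)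
  have hker : polyTuples κ K (r + 1) ⊓ LinearMap.ker Ψ ≤ (syzygies g (r + 1)).map (φ.restrict κ) :=
    fun q ⟨hq, hq0⟩ => φ.mem_map_restrict_syzygies hL hreg hg hq ((hΨ q).symm.trans hq0)
  have hmul : (syzygies g r).map (LinearMap.mulLeft K fun _ => L) ≤
      syzygies g (r + 1) ⊓ LinearMap.ker (φ.restrict κ) := by
    rintro _ ⟨ρ, hρ, rfl⟩
    exact φ.mul_mem_syzygies_inf_ker hL hρ
  have hinj : Function.Injective (LinearMap.mulLeft K fun _ : κ => L) := fun ρ τ h =>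
    _root_.funext fun i => mul_left_cancel₀ hL0 (congrFun h i)
  have hpoly := finrank_map_add_finrank_inf_ker (polyTuples κ K (r + 1)) Ψ
  have hsyz := finrank_map_add_finrank_inf_ker (syzygies g (r + 1)) (φ.restrict κ)
  have hmap' := Submodule.finrank_mono hmap
  have hker' := Submodule.finrank_mono hker
  have hmul' := Submodule.finrank_mono hmul
  rw [finrank_polyTuples, add_assoc, one_add_one_eq_two] at hpoly
  rw [finrank_degreeLT] at hmap'
  rw [← (Submodule.equivMapOfInjective _ hinj _).finrank_eq] at hmul'
  omega

end RationalParam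

end Syzygies

theorem IsFree.finrank_syzygies_succ {f : S} (hf : IsFree f) {m : ℕ} (hm : f.IsHomogeneous (m + 1))
    (r : ℕ) : 3 * (r + 2) + Module.finrank ℂ (syzygies (fun i => pderiv i f) r) ≤
      Module.finrank ℂ (syzygies (fun i => pderiv i f) (r + 1)) + (r + m + 2) := by
  obtain ⟨a, ha0, ha⟩ := exists_linForm_mem_of_mul_mem fun h => hf.mem_of_X_mul_mem (h := h)
  have hL0 : linForm a ≠ 0 := fun h => ha0 (linForm_injective (h.trans (map_zero _).symm))
  obtain ⟨q, hq, hLq⟩ := exists_ne_zero_eval_eq_zero (isHomogeneous_linForm a) one_ne_zero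
  obtain ⟨φ, -⟩ := exists_rationalParam_line (isHomogeneous_linForm a) hL0 hq hLq
  simpa using φ.finrank_syzygies_succ (r := r) (isHomogeneous_linForm a) hL0 ha
    fun i => hm.pderiv (i := i)

section Contraction

variable {K : Type*} [Field K] {f g Z : MvPolynomial (Fin 3) K}
  {ρ : Fin 3 → MvPolynomial (Fin 3) K} {d r : ℕ}

variable (K) in
/-- The `1`-form obtained by contracting the volume form with the Euler field and a vector field. -/
def contract : (Fin 3 → MvPolynomial (Fin 3) K) →ₗ[K] (Fin 3 → MvPolynomial (Fin 3) K) where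
  toFun ρ := ![X 1 * ρ 2 - X 2 * ρ 1, X 2 * ρ 0 - X 0 * ρ 2, X 0 * ρ 1 - X 1 * ρ 0]
  map_add' ρ τ := by
    ext1 i
    fin_cases i <;>
      simp only [Pi.add_apply, Fin.zero_eta, Fin.mk_one, Fin.reduceFinMk, Matrix.cons_val_zero,
        Matrix.cons_val_one, Matrix.cons_val] <;>
      ring
  map_smul' c ρ := by
    ext1 i
    fin_cases i <;> simp [smul_sub]

theorem isHomogeneous_contract (hρ : ∀ i, (ρ i).IsHomogeneous r) (i : Fin 3) :
    (contract K ρ i).IsHomogeneous (r + 1) := by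
  have hX (i j : Fin 3) : (X i * ρ j).IsHomogeneous (r + 1) :=
    add_comm 1 r ▸ (isHomogeneous_X K i).mul (hρ j)
  fin_cases i
  · exact (hX 1 2).sub (hX 2 1)
  · exact (hX 2 0).sub (hX 0 2)
  · exact (hX 0 1).sub (hX 1 0)

theorem sum_X_mul_contract (ρ : Fin 3 → MvPolynomial (Fin 3) K) :
    ∑ i, X i * contract K ρ i = 0 := by
  simp only [contract, LinearMap.coe_mk, AddHom.coe_mk, Fin.sum_univ_three,
    Matrix.cons_val_zero, Matrix.cons_val_one, Matrix.cons_val]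
  ring

theorem dvd_sum_mul_pderiv (hZ : Prime Z) (hg : ¬ Z ∣ g)
    (h : ∑ i, ρ i * pderiv i (Z * g) = 0) : Z ∣ ∑ i, ρ i * pderiv i Z := by
  refine (hZ.dvd_or_dvd (⟨-∑ i, ρ i * pderiv i g, ?_⟩ : Z ∣ g * _)).resolve_left hg
  simp only [Derivation.leibniz, smul_eq_mul, Fin.sum_univ_three] at h ⊢
  linear_combination h

/-- By Euler's formula `dZ ∧ contract ρ` is `Z` times a form, up to multiples of `ρ Z`. -/
theorem dvd_pderiv_mul_contract_sub (hZ : Z.IsHomogeneous d) (hρ : Z ∣ ∑ i, ρ i * pderiv i Z)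
    (a b : Fin 3) : Z ∣ pderiv a Z * contract K ρ b - pderiv b Z * contract K ρ a := by
  obtain ⟨w, hw⟩ := hρ
  have hE := hZ.sum_X_mul_pderiv
  rw [nsmul_eq_mul] at hE
  rw [Fin.sum_univ_three] at hw hE
  let q (i : Fin 3) : MvPolynomial (Fin 3) K := X i * w - (d : MvPolynomial (Fin 3) K) * ρ i
  fin_cases a <;> fin_cases b <;>
    simp only [contract, LinearMap.coe_mk, AddHom.coe_mk, Fin.zero_eta, Fin.mk_one,
      Fin.reduceFinMk, Matrix.cons_val_zero, Matrix.cons_val_one, Matrix.cons_val, sub_self,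
      dvd_zero]
  · exact ⟨q 2, by linear_combination X 2 * hw - ρ 2 * hE⟩
  · exact ⟨-q 1, by linear_combination -X 1 * hw + ρ 1 * hE⟩
  · exact ⟨-q 2, by linear_combination -X 2 * hw + ρ 2 * hE⟩
  · exact ⟨q 0, by linear_combination X 0 * hw - ρ 0 * hE⟩
  · exact ⟨q 1, by linear_combination X 1 * hw - ρ 1 * hE⟩
  · exact ⟨-q 0, by linear_combination -X 0 * hw + ρ 0 * hE⟩

theorem eq_zero_of_contract_eq_zero (hf : f.IsHomogeneous d) (hd : (d : K) ≠ 0) (hf0 : f ≠ 0)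
    (hρ : ∑ i, ρ i * pderiv i f = 0) (h : contract K ρ = 0) : ρ = 0 := by
  have e0 : X 1 * ρ 2 - X 2 * ρ 1 = 0 := congrFun h 0
  have e1 : X 2 * ρ 0 - X 0 * ρ 2 = 0 := congrFun h 1
  have e2 : X 0 * ρ 1 - X 1 * ρ 0 = 0 := congrFun h 2
  have hE := hf.sum_X_mul_pderiv
  rw [nsmul_eq_mul, Fin.sum_univ_three] at hE
  rw [Fin.sum_univ_three] at hρ
  have hdf : (d : MvPolynomial (Fin 3) K) * f ≠ 0 := mul_ne_zero (by
    rw [← map_natCast (C : K →+* MvPolynomial (Fin 3) K), Ne, C_eq_zero]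
    exact hd) hf0
  ext1 i
  refine (mul_eq_zero.mp (?_ : ρ i * (d * f) = 0)).resolve_right hdf
  rw [← hE]
  fin_cases i <;> simp only [Fin.zero_eta, Fin.mk_one, Fin.reduceFinMk]
  · linear_combination X 0 * hρ - pderiv 1 f * e2 + pderiv 2 f * e1
  · linear_combination X 1 * hρ + pderiv 0 f * e2 - pderiv 2 f * e0
  · linear_combination X 2 * hρ - pderiv 0 f * e1 + pderiv 1 f * e0

theorem CurveSystem.finrank_syzygies_le {ι : Type*} {Z : ι → MvPolynomial (Fin 3) K} {e : ι → ℕ}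
    (H : CurveSystem Z e) {Y : Finset ι} (he : ((∑ j ∈ Y, e j : ℕ) : K) ≠ 0) :
    Module.finrank K (syzygies (fun i => pderiv i (∏ j ∈ Y, Z j)) r) ≤
      Module.finrank K (logForms Z Y (r + 1)) := by
  classical
  rw [← add_zero (Module.finrank K (logForms Z Y (r + 1))),
    ← finrank_bot K (Fin 3 → MvPolynomial (Fin 3) K)]
  refine finrank_le_finrank_add_finrank_of_le (contract K) ?_ ?_
  · rintro ρ hρ
    obtain ⟨hρr, hρf⟩ := mem_syzygies.mp hρ
    refine ⟨isHomogeneous_contract hρr, sum_X_mul_contract ρ, fun j hj =>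
      dvd_pderiv_mul_contract_sub (H.isHomogeneous j) (dvd_sum_mul_pderiv (H.prime j)
        (g := ∏ i ∈ Y.erase j, Z i) (fun h => ?_) ?_)⟩
    · obtain ⟨i, hi, hij⟩ := (H.prime j).exists_mem_finset_dvd h
      exact H.not_dvd j i (Finset.ne_of_mem_erase hi).symm hij
    · rwa [Finset.mul_prod_erase Y Z hj]
  · rintro ρ ⟨hρ, hker⟩
    exact eq_zero_of_contract_eq_zero (IsHomogeneous.prod _ _ _ fun j _ => H.isHomogeneous j) he
      (Finset.prod_ne_zero_iff.mpr fun j _ => H.ne_zero j) (mem_syzygies.mp hρ).2 hker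

end Contraction

/-! ### Counting intersection points -/

namespace CurveSystem

variable {ι σ K : Type*} [Field K] {Z : ι → MvPolynomial σ K} {e : ι → ℕ} (H : CurveSystem Z e)
  {i j l : ι} {Y : Finset ι} {t : K}

/-- The intersection multiplicity of the `i`-th curve with the union of the curves `Z j = 0`,
`j ∈ Y`, at the point with parameter `t`. -/
def mult (i : ι) (Y : Finset ι) (t : K) : ℕ := (H.trace i Y).rootMultiplicity t

/-- The parameters of the points where the `i`-th curve meets the union of the curves `Z j = 0`,
`j ∈ Y`, with multiplicity one. -/
def simplePoints (i : ι) (Y : Finset ι) : Finset K :=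
  (H.points i Y).filter fun t => H.mult i Y t = 1

theorem mult_le_two (hi : i ∉ Y) : H.mult i Y t ≤ 2 := H.rootMultiplicity_le_two i Y hi t

theorem mult_pos_iff (hi : i ∉ Y) : 0 < H.mult i Y t ↔ t ∈ H.points i Y := by
  classical
  rw [mult, Polynomial.rootMultiplicity_pos (H.trace_ne_zero hi), points, Multiset.mem_toFinset,
    Polynomial.mem_roots (H.trace_ne_zero hi)]

theorem mem_points_singleton (hij : i ≠ j) :
    t ∈ H.points i {j} ↔ eval ((H.param i).point t) (Z j) = 0 := by
  simp [H.mem_points (Finset.notMem_singleton.mpr hij)]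

theorem mult_insert [DecidableEq ι] (hj : j ∉ Y) (hi : i ∉ insert j Y) :
    H.mult i (insert j Y) t = H.mult i {j} t + H.mult i Y t := by
  have h0 := H.trace_ne_zero hi
  rw [trace, Finset.prod_insert hj] at h0
  rw [mult, mult, mult, trace, Finset.prod_insert hj, Polynomial.rootMultiplicity_mul h0, trace,
    Finset.prod_singleton, trace]

theorem mem_simplePoints (hi : i ∉ Y) : t ∈ H.simplePoints i Y ↔ H.mult i Y t = 1 := by
  rw [simplePoints, Finset.mem_filter, ← H.mult_pos_iff hi]
  omega

theorem mem_simplePoints_of_mem_points [DecidableEq ι] (hj : j ∉ Y) (hi : i ∉ insert j Y)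
    (htj : t ∈ H.points i {j}) (htY : t ∈ H.points i Y) : t ∈ H.simplePoints i Y := by
  obtain ⟨hij, hiY⟩ := not_or.mp (Finset.mem_insert.not.mp hi)
  have hle := H.mult_le_two (t := t) hi
  have hposj := (H.mult_pos_iff (Finset.notMem_singleton.mpr hij)).mpr htj
  have hposY := (H.mult_pos_iff hiY).mpr htY
  rw [H.mult_insert hj hi] at hle
  exact (H.mem_simplePoints hiY).mpr (by omega)

theorem mult_eq_sum (hi : i ∉ Y) : H.mult i Y t = ∑ j ∈ Y, H.mult i {j} t := by
  classical
  induction Y using Finset.induction_on with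
  | empty => simp [mult, trace]
  | insert j Y hj ih =>
    rw [H.mult_insert hj hi, Finset.sum_insert hj,
      ih fun h => hi (Finset.mem_insert_of_mem h)]

theorem card_le_two_of_eval_point_eq_zero (hi : i ∉ Y)
    (h : ∀ j ∈ Y, eval ((H.param i).point t) (Z j) = 0) : Y.card ≤ 2 := by
  have hpos : ∀ j ∈ Y, 1 ≤ H.mult i {j} t := fun j hj => by
    have hij : i ≠ j := (ne_of_mem_of_not_mem hj hi).symm
    exact (H.mult_pos_iff (Finset.notMem_singleton.mpr hij)).mpr
      ((H.mem_points_singleton hij).mpr (h j hj))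
  calc Y.card = Y.card • 1 := (mul_one _).symm
    _ ≤ ∑ j ∈ Y, H.mult i {j} t := Finset.card_nsmul_le_sum _ _ _ hpos
    _ = H.mult i Y t := (H.mult_eq_sum hi).symm
    _ ≤ 2 := H.mult_le_two hi

theorem exists_eq_smul_point {y : σ → K} (hi : i ∉ Y) (hy : y ≠ 0) (hyi : eval y (Z i) = 0)
    (hyY : ∃ j ∈ Y, eval y (Z j) = 0) :
    ∃ t ∈ H.points i Y, ∃ c : K, c ≠ 0 ∧ y = c • (H.param i).point t := by
  obtain ⟨j, hj, hyj⟩ := hyY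
  rcases (H.param i).eq_smul_point_or_eq_smul_infinity hyi with ⟨t, c, rfl⟩ | ⟨c, rfl⟩
  all_goals
    have hc : c ≠ 0 := left_ne_zero_of_smul hy
    rw [eval_smul_eq_zero_iff (H.isHomogeneous j) hc] at hyj
  · exact ⟨t, (H.mem_points hi).mpr ⟨j, hj, hyj⟩, c, hc, rfl⟩
  · exact absurd hyj (H.eval_infinity_ne_zero i j (ne_of_mem_of_not_mem hj hi).symm)

include H in
theorem card_le_three_of_eval_eq_zero {y : σ → K} (hy : y ≠ 0)
    (h : ∀ j ∈ Y, eval y (Z j) = 0) : Y.card ≤ 3 := by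
  classical
  by_contra! hY
  obtain ⟨i, hi, j, hj, hij⟩ := Finset.one_lt_card.mp (by omega : 1 < Y.card)
  have hiY := Finset.notMem_erase i Y
  obtain ⟨t, -, c, hc, rfl⟩ := H.exists_eq_smul_point hiY hy (h i hi)
    ⟨j, Finset.mem_erase.mpr ⟨hij.symm, hj⟩, h j hj⟩
  have hcard := H.card_le_two_of_eval_point_eq_zero hiY fun l hl =>
    (eval_smul_eq_zero_iff (H.isHomogeneous l) hc _).mp (h l (Finset.mem_of_mem_erase hl))
  rw [Finset.card_erase_of_mem hi] at hcard
  omega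

theorem mem_points_of_point_eq_smul {t' c : K} (hi : i ∉ Y) (hj : j ∉ Y) (hc : c ≠ 0)
    (h : (H.param i).point t = c • (H.param j).point t') (ht' : t' ∈ H.points j Y) :
    t ∈ H.points i Y := by
  obtain ⟨l, hl, hlt⟩ := (H.mem_points hj).mp ht'
  exact (H.mem_points hi).mpr
    ⟨l, hl, by rwa [h, eval_smul_eq_zero_iff (H.isHomogeneous l) hc]⟩

theorem exists_point_eq_smul_point (hij : i ≠ j) (ht : t ∈ H.points i {j}) :
    ∃ t' ∈ H.points j {i}, ∃ c : K, c ≠ 0 ∧ (H.param i).point t = c • (H.param j).point t' :=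
  H.exists_eq_smul_point (Finset.notMem_singleton.mpr hij.symm)
    ((H.param i).point_ne_zero t) ((H.mem_points_singleton hij).mp ht)
    ⟨i, Finset.mem_singleton_self i, (H.param i).eval_point_self t⟩

theorem card_points_singleton_le (hij : i ≠ j) :
    (H.points i {j}).card ≤ (H.points j {i}).card := by
  refine Finset.card_le_card_of_forall_subsingleton
    (fun t t' => ∃ c : K, c ≠ 0 ∧ (H.param i).point t = c • (H.param j).point t')
    (fun t ht => H.exists_point_eq_smul_point hij ht) ?_
  rintro t' - t₁ ⟨-, c₁, -, h₁⟩ t₂ ⟨-, c₂, hc₂, h₂⟩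
  refine (H.param i).eq_of_point_eq_smul (c := c₁ * c₂⁻¹) ?_
  rw [h₁, h₂, smul_smul, inv_mul_cancel_right₀ hc₂]

theorem exists_eq_smul_of_card_points_le_one {y z : σ → K} (hij : i ≠ j)
    (h : (H.points i {j}).card ≤ 1) (hy : y ≠ 0) (hyi : eval y (Z i) = 0) (hyj : eval y (Z j) = 0)
    (hz : z ≠ 0) (hzi : eval z (Z i) = 0) (hzj : eval z (Z j) = 0) :
    ∃ c : K, c ≠ 0 ∧ y = c • z := by
  have hij' := Finset.notMem_singleton.mpr hij
  obtain ⟨t, ht, b, hb, rfl⟩ :=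
    H.exists_eq_smul_point hij' hy hyi ⟨j, Finset.mem_singleton_self j, hyj⟩
  obtain ⟨t', ht', c, hc, rfl⟩ :=
    H.exists_eq_smul_point hij' hz hzi ⟨j, Finset.mem_singleton_self j, hzj⟩
  rw [Finset.card_le_one.mp h t ht t' ht']
  exact ⟨b * c⁻¹, mul_ne_zero hb (inv_ne_zero hc), by
    rw [smul_smul, inv_mul_cancel_right₀ hc]⟩

section Bezout

variable [IsAlgClosed K]

theorem sum_mult (hi : i ∉ Y) : ∑ t ∈ H.points i Y, H.mult i Y t = e i * ∑ j ∈ Y, e j := by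
  classical
  rw [← H.natDegree_trace hi, ← IsAlgClosed.card_roots_eq_natDegree,
    ← Multiset.toFinset_sum_count_eq]
  exact Finset.sum_congr (by simp only [points]) fun t _ => (Polynomial.count_roots _).symm

/-- Bézout's theorem, all intersection multiplicities being one or two. -/
theorem mul_sum_add_card_simplePoints (hi : i ∉ Y) :
    e i * ∑ j ∈ Y, e j + (H.simplePoints i Y).card = 2 * (H.points i Y).card := by
  rw [← H.sum_mult hi, simplePoints, Finset.card_filter, ← Finset.sum_add_distrib, mul_comm]
  refine Finset.sum_eq_card_nsmul fun t ht => ?_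
  have hpos := (H.mult_pos_iff hi).mpr ht
  have hle := H.mult_le_two (t := t) hi
  split_ifs <;> omega

theorem card_points_le (hi : i ∉ Y) : (H.points i Y).card ≤ e i * ∑ j ∈ Y, e j := by
  have hle : (H.simplePoints i Y).card ≤ (H.points i Y).card := Finset.card_filter_le _ _
  have := H.mul_sum_add_card_simplePoints hi
  omega

theorem card_points_singleton_le_one (hij : i ≠ j) (hi : e i = 1) (hj : e j = 1) :
    (H.points i {j}).card ≤ 1 := by
  simpa [hi, hj] using H.card_points_le (Finset.notMem_singleton.mpr hij)

theorem points_nonempty (hi : i ∉ Y) (h : e i * ∑ j ∈ Y, e j ≠ 0) : (H.points i Y).Nonempty := by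
  refine Finset.nonempty_iff_ne_empty.mpr fun h0 => h ?_
  rw [← H.sum_mult hi, h0, Finset.sum_empty]

theorem mult_eq_of_card_points_le_one (hi : i ∉ Y) (h : (H.points i Y).card ≤ 1)
    (ht : t ∈ H.points i Y) : H.mult i Y t = e i * ∑ j ∈ Y, e j := by
  rw [← H.sum_mult hi, Finset.eq_singleton_iff_unique_mem.mpr
    ⟨ht, fun t' ht' => Finset.card_le_one.mp h t' ht' t ht⟩, Finset.sum_singleton]

theorem mult_eq_one_of_two_le_card_points (hij : i ≠ j) (he : e i * e j = 2)
    (h : 2 ≤ (H.points i {j}).card) (ht : t ∈ H.points i {j}) : H.mult i {j} t = 1 := by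
  have hij' := Finset.notMem_singleton.mpr hij
  have hbezout := H.mul_sum_add_card_simplePoints hij'
  have hle := H.card_points_le hij'
  rw [Finset.sum_singleton, he] at hbezout hle
  have hsub : H.simplePoints i {j} ⊆ H.points i {j} := Finset.filter_subset _ _
  rwa [← H.mem_simplePoints hij', Finset.eq_of_subset_of_card_le hsub (by omega)]

theorem two_le_card_points_pair [DecidableEq ι] (hij : i ≠ j) (hil : i ≠ l) (hi : e i ≠ 0)
    (hj : e j ≠ 0) (hl : e l ≠ 0) (h : ∀ t ∈ H.points i {j}, t ∉ H.points i {l}) :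
    2 ≤ (H.points i {j, l}).card := by
  obtain ⟨t, ht⟩ := H.points_nonempty (Finset.notMem_singleton.mpr hij) (by simp [hi, hj])
  obtain ⟨t', ht'⟩ := H.points_nonempty (Finset.notMem_singleton.mpr hil) (by simp [hi, hl])
  refine Finset.one_lt_card.mpr ⟨t, ?_, t', ?_, fun htt => h t ht (htt ▸ ht')⟩
  · simp [H.mem_points, hij, hil, (H.mem_points_singleton hij).mp ht]
  · simp [H.mem_points, hij, hil, (H.mem_points_singleton hil).mp ht']

end Bezout

section LogForms

variable [IsAlgClosed K] [CharZero K] [Fintype σ] {T D : Finset ι} {s : ℕ}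

include H

theorem finrank_logForms_triangle_eq_zero (hT : T.card = 3) (hT1 : ∀ j ∈ T, e j = 1)
    (hcon : ∀ y : σ → K, y ≠ 0 → ∃ j ∈ T, eval y (Z j) ≠ 0) (hs : s ≤ 1) :
    Module.finrank K (logForms Z T s) = 0 := by
  classical
  obtain ⟨i, j, l, hij, hil, -, rfl⟩ := Finset.card_eq_three.mp hT
  simp only [Finset.mem_insert, Finset.mem_singleton, forall_eq_or_imp, forall_eq,
    exists_eq_or_imp, exists_eq_left] at hT1 hcon
  obtain ⟨hi1, hj1, hl1⟩ := hT1
  have hle := H.finrank_logForms_insert_le (i := i) (Y := {j, l}) (by simp [hij, hil]) s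
  have hpts : 2 ≤ (H.points i {j, l}).card := by
    refine H.two_le_card_points_pair hij hil (by simp [hi1]) (by simp [hj1]) (by simp [hl1])
      fun t htj htl => ?_
    rw [H.mem_points_singleton hij] at htj
    rw [H.mem_points_singleton hil] at htl
    simpa [htj, htl, RationalParam.eval_point_self] using hcon _ ((H.param i).point_ne_zero t)
  rw [show s - e i = 0 by omega, logForms_zero, finrank_bot, hi1] at hle
  omega

theorem finrank_logForms_union_triangle_eq_zero [DecidableEq ι] (hT : T.card = 3)
    (hT1 : ∀ j ∈ T, e j = 1)
    (hcon : ∀ y : σ → K, y ≠ 0 → ∃ j ∈ T, eval y (Z j) ≠ 0) (hD : ∀ j ∈ D, e j = 2)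
    (hs : s ≤ D.card + 1) : Module.finrank K (logForms Z (D ∪ T) s) = 0 := by
  induction D using Finset.induction_on generalizing s with
  | empty =>
    rw [Finset.empty_union]
    exact H.finrank_logForms_triangle_eq_zero hT hT1 hcon (by simpa using hs)
  | insert c D hc ih =>
    obtain ⟨hc2, hD⟩ := (Finset.forall_mem_insert c D _).mp hD
    have hcT : c ∉ D ∪ T := by
      rw [Finset.mem_union]
      rintro (h | h)
      · exact hc h
      · exact absurd ((hT1 c h).symm.trans hc2) (by norm_num)
    have hdisj : Disjoint D T := Finset.disjoint_left.mpr fun j hjD hjT =>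
      absurd ((hT1 j hjT).symm.trans (hD j hjD)) (by norm_num)
    have hsum : ∑ j ∈ D ∪ T, e j = 2 * D.card + 3 := by
      rw [Finset.sum_union hdisj, Finset.sum_congr rfl hD, Finset.sum_congr rfl hT1]
      simp [hT, mul_comm]
    rw [Finset.card_insert_of_notMem hc] at hs
    have hle := H.finrank_logForms_insert_le hcT s
    have hbezout := H.mul_sum_add_card_simplePoints hcT
    rw [hsum, hc2] at hbezout
    rw [hc2, ih hD (by omega)] at hle
    rw [Finset.insert_union]
    omega

end LogForms

end CurveSystem

/-! ### Concurrent tangents of a conic -/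

theorem linearIndependent_X_add_C_pow {K : Type*} [Field K] [CharZero K] {n : ℕ}
    {τ : Fin (n + 1) → K} (hτ : Function.Injective τ) :
    LinearIndependent K fun i => (Polynomial.X + Polynomial.C (τ i)) ^ n := by
  refine Fintype.linearIndependent_iff.mpr fun w hw => congrFun
    (Matrix.eq_zero_of_forall_pow_sum_mul_pow_eq_zero hτ fun m => ?_)
  have hcoeff := congrArg (Polynomial.coeff · (n - m)) hw
  simp only [Polynomial.finsetSum_coeff, Polynomial.coeff_smul, Polynomial.coeff_X_add_C_pow,
    Polynomial.coeff_zero, smul_eq_mul, Nat.sub_sub_self m.is_le, ← mul_assoc,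
    ← Finset.sum_mul] at hcoeff
  exact (mul_eq_zero.mp hcoeff).resolve_right
    (Nat.cast_ne_zero.mpr (Nat.choose_pos (Nat.sub_le n m)).ne')

theorem not_linearIndependent_of_eval_eq_zero {σ K : Type*} [Field K] [Finite σ]
    {P : σ → MvPolynomial σ K} (hP : ∀ i, (P i).IsHomogeneous 1) {y : σ → K} (hy : y ≠ 0)
    (h : ∀ i, eval y (P i) = 0) : ¬ LinearIndependent K P := by
  classical
  cases nonempty_fintype σ
  intro hli
  choose v hv using fun i => exists_linForm_eq (hP i)
  have hrows : LinearIndependent K (Matrix.of v).row := by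
    refine LinearIndependent.of_comp linForm ?_
    change LinearIndependent K fun i => linForm (v i)
    rwa [_root_.funext hv]
  refine hy (Matrix.mulVec_injective_of_isUnit
    (Matrix.linearIndependent_rows_iff_isUnit.mp hrows) ?_)
  rw [Matrix.mulVec_zero]
  ext1 i
  rw [Pi.zero_apply, ← h i, ← hv i, eval_linForm]
  rfl

namespace CurveSystem

variable {ι σ K : Type*} [Field K] [IsAlgClosed K] {Z : ι → MvPolynomial σ K} {e : ι → ℕ}

theorem exists_aeval_coord_eq_smul_X_sub_C_pow (H : CurveSystem Z e) {i j : ι} (hij : i ≠ j)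
    (h : (H.points i {j}).card ≤ 1) {t : K} (ht : t ∈ H.points i {j}) :
    ∃ κ : K, κ ≠ 0 ∧ aeval (H.param i).coord (Z j) =
      κ • (Polynomial.X - Polynomial.C t) ^ (e i * e j) := by
  have hij' := Finset.notMem_singleton.mpr hij
  have hmult := H.mult_eq_of_card_points_le_one hij' h ht
  have hdeg := H.natDegree_trace hij'
  rw [Finset.sum_singleton] at hmult hdeg
  rw [mult] at hmult
  have hdvd := Polynomial.pow_rootMultiplicity_dvd (H.trace i {j}) t
  rw [hmult] at hdvd
  refine ⟨(H.trace i {j}).leadingCoeff, Polynomial.leadingCoeff_ne_zero.mpr (H.trace_ne_zero hij'),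
    ?_⟩
  rw [Polynomial.smul_eq_C_mul, ← Polynomial.eq_leadingCoeff_mul_of_monic_of_dvd_of_natDegree_le
    ((Polynomial.monic_X_sub_C t).pow _) hdvd (by simp [hdeg]), trace, Finset.prod_singleton]

variable [CharZero K] {Z : ι → MvPolynomial (Fin 3) K}

/-- In the coordinate of the conic, the equations of the tangents are squares, and three pairwise
non-proportional squares of linear polynomials are linearly independent. -/
theorem exists_one_lt_card_points_of_concurrent (H : CurveSystem Z e) {l : Fin 3 → ι}
    (hl : Function.Injective l) (hl1 : ∀ i, e (l i) = 1) {c : ι} (hc : e c = 2) {y : Fin 3 → K}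
    (hy : y ≠ 0) (h : ∀ i, eval y (Z (l i)) = 0) : ∃ i, 1 < (H.points c {l i}).card := by
  classical
  by_contra! htan
  have hne (i : Fin 3) : c ≠ l i := fun hcl => absurd (hcl ▸ hc) (by simp [hl1])
  have hmem (i : Fin 3) : c ∉ ({l i} : Finset ι) := Finset.notMem_singleton.mpr (hne i)
  choose τ hτ using fun i => H.points_nonempty (hmem i) (by simp [hc, hl1])
  have hτinj : Function.Injective τ := by
    intro i j hij
    by_contra hne'
    have hlij : l i ∉ ({l j} : Finset ι) := Finset.notMem_singleton.mpr (hl.ne hne')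
    have hpair : c ∉ ({l i, l j} : Finset ι) := by simp [hne]
    have hmult (m : Fin 3) := H.mult_eq_of_card_points_le_one (hmem m) (htan m) (hτ m)
    have hle := H.mult_le_two (t := τ i) hpair
    rw [H.mult_insert hlij hpair, hmult i, hij, hmult j] at hle
    simp [hc, hl1] at hle
  choose κ hκ hsq using fun i => H.exists_aeval_coord_eq_smul_X_sub_C_pow (hne i) (htan i) (hτ i)
  have hli := (linearIndependent_X_add_C_pow (neg_injective.comp hτinj)).units_smul
    fun i => Units.mk0 (κ i) (hκ i)
  refine not_linearIndependent_of_eval_eq_zero (fun i => hl1 i ▸ H.isHomogeneous (l i)) hy h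
    (LinearIndependent.of_comp (aeval (H.param c).coord).toLinearMap ?_)
  convert hli using 1
  · ext1 i
    simp [hsq, hc, hl1, Units.smul_def, sub_eq_add_neg]
  · rfl

end CurveSystem

/-! ### Arrangements of lines and conics -/

namespace Arrangement

variable {d k : ℕ} (A : Arrangement d k)

/-- The equations of the lines and of the conics of an arrangement, as one family. -/
def component : Fin d ⊕ Fin k → S := Sum.elim A.line A.conic

/-- The degrees of the components of an arrangement of `d` lines and `k` conics. -/
def componentDegree (d k : ℕ) : Fin d ⊕ Fin k → ℕ := Sum.elim (fun _ => 1) fun _ => 2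

@[simp]
theorem componentDegree_inl (i : Fin d) : componentDegree d k (.inl i) = 1 := rfl

@[simp]
theorem componentDegree_inr (i : Fin k) : componentDegree d k (.inr i) = 2 := rfl

theorem equation_eq_prod : A.equation = ∏ i, A.component i := by
  simp [equation, component, Fintype.prod_sum_type]

theorem isHomogeneous_component (i : Fin d ⊕ Fin k) :
    (A.component i).IsHomogeneous (componentDegree d k i) :=
  match i with
  | .inl i => A.line_isHomogeneous i
  | .inr i => A.conic_isHomogeneous i

theorem sum_componentDegree : ∑ i, componentDegree d k i = d + 2 * k := by
  simp [Fintype.sum_sum_type, mul_comm]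

theorem isHomogeneous_equation : A.equation.IsHomogeneous (d + 2 * k) := by
  rw [equation_eq_prod, ← sum_componentDegree]
  exact IsHomogeneous.prod _ _ _ fun i _ => A.isHomogeneous_component i

theorem component_ne_zero (i : Fin d ⊕ Fin k) : A.component i ≠ 0 :=
  match i with
  | .inl i => A.line_ne_zero i
  | .inr i => fun h => A.conic_smooth i 1 one_ne_zero (by
      rw [component, Sum.elim_inr] at h
      simp [IsSingularAt, h])

theorem eq_zero_of_pderiv_component (i : Fin d ⊕ Fin k) (v : Fin 3 → ℂ)
    (h : ∀ a, eval v (pderiv a (A.component i)) = 0) : v = 0 := by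
  by_contra hv
  rcases i with i | i
  · obtain ⟨b, hb⟩ := exists_linForm_eq (A.line_isHomogeneous i)
    refine A.line_ne_zero i ?_
    rw [← hb, show b = 0 from _root_.funext fun a => ?_, map_zero]
    simpa [component, ← hb, pderiv_linForm] using h a
  · refine A.conic_smooth i v hv ⟨?_, h⟩
    have hE := congrArg (eval v) (A.conic_isHomogeneous i).sum_X_mul_pderiv
    rw [map_sum, map_nsmul, Finset.sum_eq_zero fun a _ => by
      rw [map_mul]; exact mul_eq_zero_of_right _ (h a)] at hE
    simpa using hE.symm

theorem exists_rationalParam_component (i : Fin d ⊕ Fin k) {q : Fin 3 → ℂ} (hq : q ≠ 0)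
    (hiq : eval q (A.component i) = 0) :
    ∃ φ : RationalParam (A.component i) (componentDegree d k i), φ.infinity = q :=
  match i with
  | .inl i => exists_rationalParam_line (A.line_isHomogeneous i) (A.line_ne_zero i) hq hiq
  | .inr i => exists_rationalParam_conic two_ne_zero (A.conic_isHomogeneous i)
      (A.eq_zero_of_pderiv_component (.inr i)) hq hiq

theorem componentDegree_ne_zero (i : Fin d ⊕ Fin k) : componentDegree d k i ≠ 0 :=
  match i with
  | .inl _ => one_ne_zero
  | .inr _ => two_ne_zero

theorem prime_component (i : Fin d ⊕ Fin k) : Prime (A.component i) := by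
  obtain ⟨q, hq, hiq⟩ :=
    exists_ne_zero_eval_eq_zero (A.isHomogeneous_component i) (componentDegree_ne_zero i)
  obtain ⟨φ, -⟩ := A.exists_rationalParam_component i hq hiq
  exact φ.prime (A.isHomogeneous_component i) (A.component_ne_zero i)

theorem not_component_dvd {i j : Fin d ⊕ Fin k} (hij : i ≠ j) :
    ¬ A.component i ∣ A.component j := by
  intro hdvd
  have hass := (A.prime_component i).associated_of_dvd (A.prime_component j) hdvd
  rcases i with i | i <;> rcases j with j | j
  · exact A.line_distinct i j (fun h => hij (h ▸ rfl)) hass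
  · exact A.line_ne_zero i (eq_zero_of_dvd_of_lt (A.conic_isHomogeneous j)
      (A.line_isHomogeneous i) hass.symm.dvd one_lt_two)
  · exact A.line_ne_zero j (eq_zero_of_dvd_of_lt (A.conic_isHomogeneous i)
      (A.line_isHomogeneous j) hass.dvd one_lt_two)
  · exact A.conic_distinct i j (fun h => hij (h ▸ rfl)) hass

theorem nonempty_curveSystem (hA : OnlyNodesTacnodesTriplePoints A.equation) :
    Nonempty (CurveSystem A.component (componentDegree d k)) := by
  choose φ hφ using fun i => exists_rationalParam_eval_infinity_ne_zero
    (A.isHomogeneous_component i) (componentDegree_ne_zero i)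
    (fun _ => A.exists_rationalParam_component i) (Finset.univ.erase i) A.isHomogeneous_component
    fun j hj => A.not_component_dvd (Finset.ne_of_mem_erase hj).symm
  refine ⟨φ, A.isHomogeneous_component, A.component_ne_zero, fun i j => A.not_component_dvd,
    A.eq_zero_of_pderiv_component,
    fun i j hij => hφ i j (Finset.mem_erase.mpr ⟨hij.symm, Finset.mem_univ j⟩), ?_⟩
  intro i Y hi t
  have hsubset : Y ⊆ Finset.univ.erase i := fun j hj =>
    Finset.mem_erase.mpr ⟨ne_of_mem_of_not_mem hj hi, Finset.mem_univ j⟩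
  have hothers : (∏ j ∈ Finset.univ.erase i, A.component j).IsHomogeneous
      (∑ j ∈ Finset.univ.erase i, componentDegree d k j) :=
    IsHomogeneous.prod _ _ _ fun j _ => A.isHomogeneous_component j
  have hne : aeval (φ i).coord (∏ j ∈ Finset.univ.erase i, A.component j) ≠ 0 := fun h0 => by
    obtain ⟨j, hj, hdvd⟩ := (A.prime_component i).exists_mem_finset_dvd
      ((φ i).dvd_of_aeval_coord_eq_zero hothers h0)
    exact A.not_component_dvd (Finset.ne_of_mem_erase hj).symm hdvd
  rw [equation_eq_prod, ← Finset.mul_prod_erase _ _ (Finset.mem_univ i)] at hA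
  refine (Polynomial.rootMultiplicity_le_rootMultiplicity_of_dvd hne ?_ t).trans
    (rootMultiplicity_le_two (φ i) hA hothers hne t)
  rw [map_prod]
  exact Finset.prod_dvd_prod_of_subset _ _ _ hsubset

theorem four_le_finrank_logForms {A : Arrangement 4 k}
    (H : CurveSystem A.component (componentDegree 4 k)) (hf : IsFree A.equation) :
    4 ≤ Module.finrank ℂ (logForms A.component Finset.univ (k + 3)) := by
  have hm : A.equation.IsHomogeneous ((2 * k + 3) + 1) := by
    convert A.isHomogeneous_equation using 1
    omega
  have hk := hf.finrank_syzygies_succ hm k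
  have hk1 := hf.finrank_syzygies_succ hm (k + 1)
  have hle := H.finrank_syzygies_le (Y := Finset.univ) (r := k + 1 + 1) (by
    rw [sum_componentDegree]
    exact Nat.cast_ne_zero.mpr (by omega))
  rw [← equation_eq_prod] at hle
  change 4 ≤ Module.finrank ℂ (logForms A.component Finset.univ (k + 1 + 1 + 1))
  omega

end Arrangement

/-! ### Four lines and some conics -/

namespace CurveSystem

variable {k : ℕ} {a b b' : Fin 4} {c : Fin k}

/-- The indices of all lines and conics except the line `a` and the conic `c`. -/
def others (a : Fin 4) (c : Fin k) : Finset (Fin 4 ⊕ Fin k) := {Sum.inl a, Sum.inr c}ᶜ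

theorem mem_others {j : Fin 4 ⊕ Fin k} : j ∈ others a c ↔ j ≠ .inl a ∧ j ≠ .inr c := by
  simp [others]

theorem insert_insert_others (a : Fin 4) (c : Fin k) :
    insert (.inr c) (insert (.inl a) (others a c)) = Finset.univ := by
  ext j
  simp only [Finset.mem_insert, mem_others, Finset.mem_univ, iff_true]
  tauto

theorem others_eq_union (a : Fin 4) (c : Fin k) : others a c =
    ({c}ᶜ : Finset (Fin k)).map .inr ∪ ({a}ᶜ : Finset (Fin 4)).map .inl := by
  ext (j | j) <;> simp [mem_others]

theorem sum_others (a : Fin 4) (c : Fin k) :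
    ∑ j ∈ others a c, Arrangement.componentDegree 4 k j = 2 * k + 1 := by
  have h := Finset.sum_compl_add_sum {Sum.inl a, Sum.inr c} (Arrangement.componentDegree 4 k)
  rw [Arrangement.sum_componentDegree, Finset.sum_pair Sum.inl_ne_inr,
    Arrangement.componentDegree_inl, Arrangement.componentDegree_inr] at h
  rw [others]
  omega

variable {K : Type*} [Field K] {Z : Fin 4 ⊕ Fin k → MvPolynomial (Fin 3) K}

/-- The three lines other than the line `a` have no common point, that is, they form a triangle. -/
def IsTriangleCompl (Z : Fin 4 ⊕ Fin k → MvPolynomial (Fin 3) K) (a : Fin 4) : Prop :=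
  ∀ y ≠ 0, ∃ b ≠ a, eval y (Z (.inl b)) ≠ 0

variable [IsAlgClosed K] [CharZero K] (H : CurveSystem Z (Arrangement.componentDegree 4 k))
  (hfour : 4 ≤ Module.finrank K (logForms Z Finset.univ (k + 3)))

include H in
theorem finrank_logForms_others_eq_zero (ha : IsTriangleCompl Z a) (c : Fin k) :
    Module.finrank K (logForms Z (others a c) k) = 0 := by
  have := c.pos
  rw [others_eq_union]
  refine H.finrank_logForms_union_triangle_eq_zero ?_ ?_ (fun y hy => ?_) ?_ ?_
  · simp [Finset.card_compl]
  · simp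
  · obtain ⟨b, hb, hyb⟩ := ha y hy
    exact ⟨.inl b, by simpa using hb, hyb⟩
  · simp
  · simp only [Finset.card_map, Finset.card_compl, Fintype.card_fin, Finset.card_singleton]
    omega

include hfour in
theorem card_simplePoints_conic_and_line (ha : IsTriangleCompl Z a) (c : Fin k) :
    (H.simplePoints (.inr c) (insert (.inl a) (others a c))).card = 0 ∧
      (H.simplePoints (.inl a) (others a c)).card = 1 := by
  have hc : Sum.inr c ∉ insert (Sum.inl a) (others a c) := by simp [mem_others]
  have ha' : Sum.inl a ∉ others a c := by simp [mem_others]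
  have hconic := H.finrank_logForms_insert_le hc (k + 3)
  have hline := H.finrank_logForms_insert_le ha' (k + 1)
  have hbezoutc := H.mul_sum_add_card_simplePoints hc
  have hbezouta := H.mul_sum_add_card_simplePoints ha'
  rw [Finset.sum_insert ha', sum_others] at hbezoutc
  rw [sum_others] at hbezouta
  rw [insert_insert_others, Arrangement.componentDegree_inr, show k + 3 - 2 = k + 1 from rfl]
    at hconic
  rw [Arrangement.componentDegree_inl, Nat.add_sub_cancel,
    H.finrank_logForms_others_eq_zero ha c] at hline
  rw [Arrangement.componentDegree_inl] at hbezouta hbezoutc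
  rw [Arrangement.componentDegree_inr] at hbezoutc
  omega

include hfour in
theorem card_points_line_conic_le_one (ha : IsTriangleCompl Z a) (c : Fin k) :
    (H.points (.inl a) {.inr c}).card ≤ 1 := by
  by_contra! htwo
  have hac : Sum.inl a ≠ Sum.inr c := Sum.inl_ne_inr
  have hc : Sum.inr c ∉ insert (Sum.inl a) (others a c) := by simp [mem_others]
  have hc' : Sum.inr c ∉ others a c := by simp [mem_others]
  have ha' : Sum.inl a ∉ others a c := by simp [mem_others]
  obtain ⟨hconic, hline⟩ := H.card_simplePoints_conic_and_line hfour ha c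
  obtain ⟨t, ht, hnt⟩ := Finset.exists_mem_notMem_of_card_lt_card (hline.trans_lt htwo)
  obtain ⟨t', ht', r, hr, htt'⟩ := H.exists_point_eq_smul_point hac ht
  have hmult : H.mult (.inr c) {.inl a} t' = 1 :=
    H.mult_eq_one_of_two_le_card_points hac.symm (by simp)
      (htwo.trans_le (H.card_points_singleton_le hac)) ht'
  have hne : H.mult (.inr c) (insert (.inl a) (others a c)) t' ≠ 1 := fun h1 =>
    Finset.notMem_empty t' (Finset.card_eq_zero.mp hconic ▸ (H.mem_simplePoints hc).mpr h1)
  rw [H.mult_insert ha' hc, hmult] at hne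
  exact hnt <| H.mem_simplePoints_of_mem_points hc' (by simp [mem_others]) ht
    (H.mem_points_of_point_eq_smul ha' hc' hr htt' ((H.mult_pos_iff hc').mp (by omega)))

include H hfour in
theorem isTriangleCompl (a : Fin 4) (c : Fin k) : IsTriangleCompl Z a := by
  by_contra hna
  simp only [IsTriangleCompl, not_forall, not_exists, not_and, not_not] at hna
  obtain ⟨y, hy, hya⟩ := hna
  have hother (b : Fin 4) (hb : b ≠ a) : IsTriangleCompl Z b := by
    by_contra hnb
    simp only [IsTriangleCompl, not_forall, not_exists, not_and, not_not] at hnb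
    obtain ⟨z, hz, hzb⟩ := hnb
    have htwoMore : ∀ a b : Fin 4, ∃ i j, i ≠ j ∧ i ≠ a ∧ i ≠ b ∧ j ≠ a ∧ j ≠ b := by decide
    obtain ⟨i, j, hij, hia, hib, hja, hjb⟩ := htwoMore a b
    obtain ⟨r, hr, rfl⟩ := H.exists_eq_smul_of_card_points_le_one (Sum.inl_injective.ne hij)
      (H.card_points_singleton_le_one (Sum.inl_injective.ne hij) rfl rfl)
      hy (hya i hia) (hya j hja) hz (hzb i hib) (hzb j hjb)
    have hfourLines : (Finset.univ.map .inl : Finset (Fin 4 ⊕ Fin k)).card ≤ 3 := by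
      refine H.card_le_three_of_eval_eq_zero hz fun j hj => ?_
      obtain ⟨l, -, rfl⟩ := Finset.mem_map.mp hj
      by_cases hlb : l = b
      · exact (eval_smul_eq_zero_iff (H.isHomogeneous _) hr z).mp (hya l (hlb ▸ hb))
      · exact hzb l hlb
    simp at hfourLines
  obtain ⟨i, hi⟩ := H.exists_one_lt_card_points_of_concurrent (c := .inr c)
    (l := fun i => .inl (a.succAbove i)) (Sum.inl_injective.comp a.succAbove_right_injective)
    (fun _ => rfl) rfl hy fun i => hya _ (a.succAbove_ne i)
  exact (hi.trans_le (H.card_points_singleton_le Sum.inr_ne_inl)).not_ge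
    (H.card_points_line_conic_le_one hfour (hother _ (a.succAbove_ne i)) c)

include hfour in
theorem notMem_points_line (hab : a ≠ b) (hab' : a ≠ b') (hbb' : b ≠ b') (c : Fin k) {t : K}
    (ht : t ∈ H.points (.inl a) {.inl b}) : t ∉ H.points (.inl a) {.inl b'} := by
  intro ht'
  rw [H.mem_points_singleton (Sum.inl_injective.ne hab)] at ht
  rw [H.mem_points_singleton (Sum.inl_injective.ne hab')] at ht'
  have hfourth : ∀ a b b' : Fin 4, a ≠ b → a ≠ b' → b ≠ b' →
      ∃ l, ∀ m ≠ l, m = a ∨ m = b ∨ m = b' := by decide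
  obtain ⟨l, hl⟩ := hfourth a b b' hab hab' hbb'
  obtain ⟨m, hml, hm⟩ := H.isTriangleCompl hfour l c _ ((H.param (.inl a)).point_ne_zero t)
  rcases hl m hml with rfl | rfl | rfl
  · exact hm ((H.param (.inl m)).eval_point_self t)
  · exact hm ht
  · exact hm ht'

include hfour in
theorem points_line_subset_simplePoints (hab : a ≠ b) (c : Fin k) :
    H.points (.inl a) {.inl b} ⊆ H.simplePoints (.inl a) (others a c) := by
  intro t ht
  have hab' : (Sum.inl a : Fin 4 ⊕ Fin k) ≠ Sum.inl b := Sum.inl_injective.ne hab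
  have ha : Sum.inl a ∉ others a c := by simp [mem_others]
  have hb : Sum.inl b ∈ others a c := by simp [mem_others, hab.symm]
  have hmult : H.mult (.inl a) {.inl b} t = 1 :=
    H.mult_eq_of_card_points_le_one (Finset.notMem_singleton.mpr hab')
      (H.card_points_singleton_le_one hab' rfl rfl) ht
  have hzero : ∀ j ∈ others a c, j ≠ .inl b → H.mult (.inl a) {j} t = 0 := by
    intro j hj hjb
    have hja : j ≠ .inl a := (mem_others.mp hj).1
    by_contra hpos
    have htj := (H.mult_pos_iff (Finset.notMem_singleton.mpr hja.symm)).mp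
      (Nat.pos_of_ne_zero hpos)
    rcases j with b' | c'
    · exact H.notMem_points_line hfour hab (fun h => hja (h ▸ rfl)) (fun h => hjb (h ▸ rfl)) c
        ht htj
    · have htangent := H.mult_eq_of_card_points_le_one (Finset.notMem_singleton.mpr hja.symm)
        (H.card_points_line_conic_le_one hfour (H.isTriangleCompl hfour a c) c') htj
      have hpair : Sum.inl a ∉ ({.inl b, .inr c'} : Finset (Fin 4 ⊕ Fin k)) := by simp [hab]
      have hle := H.mult_le_two (t := t) hpair
      rw [H.mult_insert (by simp) hpair, hmult, htangent] at hle
      simp at hle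
  have hsum : H.mult (.inl a) (others a c) t = 1 := by
    rw [H.mult_eq_sum ha, Finset.sum_eq_single_of_mem _ hb hzero, hmult]
  exact (H.mem_simplePoints ha).mpr hsum

include H in
theorem finrank_logForms_lt_four (c : Fin k) :
    Module.finrank K (logForms Z Finset.univ (k + 3)) < 4 := by
  by_contra! hfour
  have hinl {a b : Fin 4} (hab : a ≠ b) : (Sum.inl a : Fin 4 ⊕ Fin k) ≠ Sum.inl b :=
    Sum.inl_injective.ne hab
  have h02 : (0 : Fin 4) ≠ 2 := by decide
  have htwo := H.two_le_card_points_pair (hinl zero_ne_one) (hinl h02) one_ne_zero one_ne_zero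
    one_ne_zero fun t => H.notMem_points_line hfour zero_ne_one h02 (by decide) c
  have hsub : H.points (.inl 0) {.inl 1, .inl 2} ⊆ H.simplePoints (.inl 0) (others 0 c) := by
    intro t ht
    rw [H.mem_points (by simp)] at ht
    obtain ⟨j, hj, hjt⟩ := ht
    rcases Finset.mem_insert.mp hj with rfl | hj
    · exact H.points_line_subset_simplePoints hfour zero_ne_one c
        ((H.mem_points_singleton (hinl zero_ne_one)).mpr hjt)
    · obtain rfl := Finset.mem_singleton.mp hj
      exact H.points_line_subset_simplePoints hfour h02 c
        ((H.mem_points_singleton (hinl h02)).mpr hjt)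
  have hone := (H.card_simplePoints_conic_and_line hfour (H.isTriangleCompl hfour 0 c) c).2
  have := Finset.card_le_card hsub
  omega

end CurveSystem

end ConicLine

end

theorem mainTheorem7 (k : ℕ) (hk : 1 ≤ k) (A : ConicLine.Arrangement 4 k)
    (hA : ConicLine.OnlyNodesTacnodesTriplePoints A.equation) :
    ¬ ConicLine.IsFree A.equation := by
  intro hf
  obtain ⟨H⟩ := A.nonempty_curveSystem hA
  exact (H.finrank_logForms_lt_four ⟨0, hk⟩).not_ge
    (ConicLine.Arrangement.four_le_finrank_logForms H hf)
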